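/- Let $E\to M$ be a smooth fiber bundle, with local coordinates $x=(x^a)$ on $M$ ranging over an open set $X\subseteq\mathbb R^n$ and local coordinates $u=(u^i)$ in the fiber ranging over an open set $U\subseteq\mathbb R^m$, so that in these coordinates sections of $E$ are smooth maps $u:X\to U$ and sections of the induced bundle $E\times\mathbb R\to M\times\mathbb R$ are smooth maps $u=u(x,t):X\times\mathbb R\to U$. Let $A_i(x,u,u',u'',\dots)$, $i=1,\dots,m$, be smooth functions of $x\in X$, $u\in U$ and of the partial derivatives $u^i_{a_1\dots a_j}$ in $x$ up to some finite order (no restriction on the values of the derivatives). Variations $\delta u$ below are smooth with compact support, and the variation of a functional $F$ at $u$ is $\delta F=\frac{d}{d\varepsilon}F[u+\varepsilon\,\delta u]\big|_{\varepsilon=0}$ (the integrals are understood formally: only the support of $\delta u$ contributes to $\delta F$). The following are equivalent. (1) The $A_i$ are variational derivatives of some functional $\int L\,d^nx$, with $L$ defined locally in $u$: every $u_0\in U$ has an open neighborhood $V\subseteq U$ and a smooth function $L(x,u,u',\dots)$, of some finite order in the derivatives, defined for $x\in X$, $u\in V$, such that $A_i=\frac{\delta S}{\delta u^i}$ for $S=\int_X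 L\,d^nx$, i.e. $$\delta S=\int_X \sum_i\delta u^i\,A_i(x,u,u',\dots)\,d^nx$$ for all smooth $u:X\to V$ and all variations $\delta u:X\to\mathbb R^m$. (2) The variation of the functional $$\int_{X\times\mathbb R}\sum_i\dot u^i\,A_i(x,u,u',u'',\dots)\,d^nx\,dt,\qquad \dot u^i=\frac{\partial u^i}{\partial t},$$ (where $u',u'',\dots$ are derivatives in $x$ only) vanishes identically: it is zero for all smooth $u:X\times\mathbb R\to U$ and all variations $\delta u:X\times\mathbb R\to\mathbb R^m$. -/

import Mathlib

open MeasureTheory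
open scoped ContDiff

noncomputable section

namespace InverseProblem

/-- The multi-indices `α = (α₁, …, αₙ)` with `|α| = α₁ + ⋯ + αₙ ≤ k`. -/
def multiIndices (n k : ℕ) : Finset (Fin n → ℕ) :=
  (Fintype.piFinset fun _ : Fin n => Finset.range (k + 1)).filter fun α => ∑ a, α a ≤ k

theorem mem_multiIndices {n k : ℕ} {α : Fin n → ℕ} :
    α ∈ multiIndices n k ↔ ∑ a, α a ≤ k := by
  refine ⟨fun h => (Finset.mem_filter.1 h).2, fun h => Finset.mem_filter.2 ⟨?_, h⟩⟩
  refine Fintype.mem_piFinset.2 fun a => Finset.mem_range.2 (Nat.lt_succ_of_le ?_)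
  exact (Finset.single_le_sum (f := α) (fun _ _ => Nat.zero_le _) (Finset.mem_univ a)).trans h

/-- The zero multi-index, which labels the coordinate `u^i` itself. -/
def zeroIndex (n k : ℕ) : multiIndices n k :=
  ⟨0, mem_multiIndices.2 (by simp)⟩

/-- The fibre coordinates `(u^i_α)`, `|α| ≤ k`, of jets of order `k` of maps from `ℝⁿ` to `ℝᵐ`. -/
abbrev Jet (n m k : ℕ) : Type := Fin m → multiIndices n k → ℝ

/-- The list of directions that contains the `a`-th basis vector of `ℝⁿ` exactly `α a` times. -/
def directions {n : ℕ} (α : Fin n → ℕ) : Fin (∑ a, α a) → (Fin n → ℝ) :=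
  fun j => Pi.single (finSigmaFinEquiv.symm j).1 1

/-- The partial derivative `∂^α u^i (x)` of order `|α|`. -/
def partialDeriv {n m : ℕ} (α : Fin n → ℕ) (u : (Fin n → ℝ) → (Fin m → ℝ)) (i : Fin m)
    (x : Fin n → ℝ) : ℝ :=
  iteratedFDeriv ℝ (∑ a, α a) u x (directions α) i

/-- The fibre coordinates `(u, u', u'', …)` of the `k`-jet of `u` at `x`. -/
def jet {n m : ℕ} (k : ℕ) (u : (Fin n → ℝ) → (Fin m → ℝ)) (x : Fin n → ℝ) : Jet n m k :=
  fun i α => partialDeriv α.1 u i x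

/-- The `k`-jets `(x, u, u', …)` with `x ∈ X` and `u ∈ U`; the derivatives are unrestricted. -/
def jetDomain {n m : ℕ} (k : ℕ) (X : Set (Fin n → ℝ)) (U : Set (Fin m → ℝ)) :
    Set ((Fin n → ℝ) × Jet n m k) :=
  {q | q.1 ∈ X ∧ (fun i => q.2 i (zeroIndex n k)) ∈ U}

section Variation

/-- Smooth sections of the bundle `Ω × U → Ω`, written as maps. -/
structure IsSection {B F : Type*} [NormedAddCommGroup B] [NormedSpace ℝ B]
    [NormedAddCommGroup F] [NormedSpace ℝ F] (Ω : Set B) (U : Set F) (u : B → F) : Prop where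
  smooth : ContDiffOn ℝ ∞ u Ω
  mapsTo : Set.MapsTo u Ω U

/-- Admissible variations `δu`: smooth, with compact support inside `Ω`. -/
structure IsTestVariation {B F : Type*} [NormedAddCommGroup B] [NormedSpace ℝ B]
    [NormedAddCommGroup F] [NormedSpace ℝ F] (Ω : Set B) (η : B → F) : Prop where
  smooth : ContDiff ℝ ∞ η
  compact : HasCompactSupport η
  support_subset : tsupport η ⊆ Ω

/-- `v` is the variation at `u`, in the direction `δu = η`, of the functional `∫_Ω ℓ[u]`, that is,
`v = d/dε ∫_Ω ℓ[u + ε η]` at `ε = 0`. The integral of `ℓ[u]`, which does not depend on `ε` and may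
diverge, is subtracted under the integral sign: only the support of `η` contributes. -/
def HasVariation {B F : Type*} [MeasureSpace B] [AddCommGroup F] [Module ℝ F]
    (Ω : Set B) (ℓ : (B → F) → B → ℝ) (u η : B → F) (v : ℝ) : Prop :=
  HasDerivAt (fun ε : ℝ => ∫ x in Ω, (ℓ (u + ε • η) x - ℓ u x)) v 0

end Variation

/-- The integrand `L(x, u, u', …)` of the functional `∫ L dⁿx`, for a Lagrangian of order `k`. -/
def lagrangianDensity {n m k : ℕ} (L : (Fin n → ℝ) × Jet n m k → ℝ)
    (u : (Fin n → ℝ) → (Fin m → ℝ)) (x : Fin n → ℝ) : ℝ :=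
  L (x, jet k u x)

/-- On `X × U`, the functions `A_i` are the variational derivatives `δS/δu^i` of the functional
`S = ∫_X L dⁿx`, that is, `δS = ∫_X δu^i A_i(x, u, u', …) dⁿx` at every section `u`, for every
variation `δu` with compact support. -/
def IsVariationalDerivative {n m k l : ℕ} (X : Set (Fin n → ℝ)) (U : Set (Fin m → ℝ))
    (L : (Fin n → ℝ) × Jet n m l → ℝ) (A : Fin m → (Fin n → ℝ) × Jet n m k → ℝ) : Prop :=
  ∀ u η : (Fin n → ℝ) → (Fin m → ℝ), IsSection X U u → IsTestVariation X η →
    HasVariation X (lagrangianDensity L) u η (∫ x in X, ∑ i, η x i * A i (x, jet k u x))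

/-- On `X × U`, the functions `A_i` are variational derivatives of some functional, with a smooth
Lagrangian (of some finite order) defined locally in `u`. -/
def IsLocallyVariational {n m k : ℕ} (X : Set (Fin n → ℝ)) (U : Set (Fin m → ℝ))
    (A : Fin m → (Fin n → ℝ) × Jet n m k → ℝ) : Prop :=
  ∀ u₀ ∈ U, ∃ V : Set (Fin m → ℝ), IsOpen V ∧ u₀ ∈ V ∧ V ⊆ U ∧
    ∃ (l : ℕ) (L : (Fin n → ℝ) × Jet n m l → ℝ),
      ContDiffOn ℝ ∞ L (jetDomain l X V) ∧ IsVariationalDerivative X V L A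

/-- The integrand `u̇^i A_i(x, u, u', …)` of the functional `∫ u̇^i A_i dⁿx dt` of maps `u(x, t)`;
the dot is the derivative in `t`, the primes are derivatives in `x`. -/
def extendedDensity {n m k : ℕ} (A : Fin m → (Fin n → ℝ) × Jet n m k → ℝ)
    (u : (Fin n → ℝ) × ℝ → (Fin m → ℝ)) (q : (Fin n → ℝ) × ℝ) : ℝ :=
  ∑ i, deriv (fun t => u (q.1, t)) q.2 i * A i (q.1, jet k (fun x => u (x, q.2)) q.1)

end InverseProblem

end

open InverseProblem

namespace InverseProblem

open Filter Topology Set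


/-! ### Integrals with parameters, for integrands supported in a fixed compact set. -/

section Integrals

variable {B : Type*} [NormedAddCommGroup B] [MeasurableSpace B] [BorelSpace B]

/-! On the space of sections, `δu ↦ ∫ δu^i A_i dⁿx` is a one-form, and `∫ u̇^i A_i dⁿx dt` is its
integral along the path `t ↦ u(·, t)`. The theorem says that the form is locally exact if and only
if its path integral does not change under compactly supported deformations of the path.

If `A = δS/δu`, the inner integral is `dS/dt`, so the integral along a closed path is zero
(`IsVariationalDerivative.setIntegral_extendedDensity_eq_zero`). As `S` exists only locally in `u`,
a variation is first taken with support near one point `q₀`. There `u` may be cut off to the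
constant `u q₀` without changing the variation, and both the cut-off path and its deformation are
closed paths with values in `V`. A partition of unity handles general variations, once the variation
is known to be additive in `δu` (`hasVariation_extendedDensity_add`).

Conversely, on a ball about `u₀` let `S[v]` be the path integral along the radial path from `u₀` to
`v`; on jets this is an integral over `t` of a local expression, which gives the Lagrangian. Deform
the radial path to `u` so that it runs to `u + εη` and then returns to `u`. The deformation is
compactly supported, so `S[u + εη] - S[u]` plus the integral over the return leg has derivative zero
at `ε = 0`. The return leg contributes `-∫ η^i A_i` to first order
(`hasDerivAt_setIntegral_returnPath`), hence `δS = ∫ η^i A_i`. -/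

theorem integrableOn_of_eq_zero_off_compact {μ : Measure B} [IsFiniteMeasureOnCompacts μ]
    {Ω K : Set B} (hΩ : IsOpen Ω) (hK : IsCompact K) (hKΩ : K ⊆ Ω) {f : B → ℝ}
    (hf : ContinuousOn f Ω) (h0 : ∀ x ∈ Ω \ K, f x = 0) : IntegrableOn f Ω μ :=
  ((hf.mono hKΩ).integrableOn_compact hK).of_forall_sdiff_eq_zero hΩ.measurableSet h0

variable [NormedSpace ℝ B]

/-- Differentiation under the integral sign for integrands supported in a fixed compact set. -/
theorem hasDerivAt_setIntegral {μ : Measure B} [IsFiniteMeasureOnCompacts μ]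
    {Ω K : Set B} (hΩ : IsOpen Ω) (hK : IsCompact K) (hKΩ : K ⊆ Ω) {s : Set ℝ} (hs : IsOpen s)
    {ε₀ : ℝ} (hε₀ : ε₀ ∈ s) {g : ℝ → B → ℝ} (hg : ContDiffOn ℝ ∞ (Function.uncurry g) (s ×ˢ Ω))
    (h0 : ∀ ε ∈ s, ∀ x ∈ Ω \ K, g ε x = 0) :
    HasDerivAt (fun ε => ∫ x in Ω, g ε x ∂μ) (∫ x in Ω, deriv (fun ε => g ε x) ε₀ ∂μ) ε₀ := by
  have hopen : IsOpen (s ×ˢ Ω) := hs.prod hΩ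
  have hdiff : ∀ ε ∈ s, ∀ x ∈ Ω, HasDerivAt (fun ε => g ε x)
      (fderiv ℝ (Function.uncurry g) (ε, x) (1, 0)) ε := by
    intro ε hε x hx
    have h1 : HasFDerivAt (Function.uncurry g) (fderiv ℝ (Function.uncurry g) (ε, x)) (ε, x) :=
      ((hg.contDiffAt (hopen.mem_nhds ⟨hε, hx⟩)).differentiableAt (by simp)).hasFDerivAt
    have h2 : HasDerivAt (fun ε : ℝ => (ε, x)) ((1 : ℝ), (0 : B)) ε :=
      (hasDerivAt_id ε).prodMk (hasDerivAt_const ε x)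
    exact h1.comp_hasDerivAt ε h2
  have hcont : ContinuousOn (fun p : ℝ × B => fderiv ℝ (Function.uncurry g) p (1, 0)) (s ×ˢ Ω) :=
    (hg.continuousOn_fderiv_of_isOpen hopen (by simp)).clm_apply continuousOn_const
  obtain ⟨r, hr, hrs⟩ := Metric.nhds_basis_closedBall.mem_iff.1 (hs.mem_nhds hε₀)
  obtain ⟨C, hC⟩ := ((isCompact_closedBall ε₀ r).prod hK).exists_bound_of_continuousOn
    (hcont.mono (prod_mono hrs hKΩ))
  have hzero : ∀ ε ∈ s, ∀ x ∈ Ω \ K, fderiv ℝ (Function.uncurry g) (ε, x) (1, 0) = 0 := by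
    intro ε hε x hx
    refine (hdiff ε hε x hx.1).unique ?_
    refine (hasDerivAt_const ε (0 : ℝ)).congr_of_eventuallyEq ?_
    filter_upwards [hs.mem_nhds hε] with e he using h0 e he x hx
  have hcg : ∀ ε ∈ s, ContinuousOn (g ε) Ω := fun ε hε =>
    hg.continuousOn.comp (Continuous.prodMk_right ε).continuousOn fun x hx => ⟨hε, hx⟩
  -- The derivative vanishes off `K` and is bounded by `C` on `closedBall ε₀ r × K`, so `C` times
  -- the indicator of `K` dominates it.
  have key := hasDerivAt_integral_of_dominated_loc_of_deriv_le (μ := μ.restrict Ω) (𝕜 := ℝ)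
    (F := g) (F' := fun ε x => fderiv ℝ (Function.uncurry g) (ε, x) (1, 0))
    (bound := K.indicator fun _ => C) (x₀ := ε₀) (Metric.closedBall_mem_nhds ε₀ hr)
    ?_ ?_ ?_ ?_ ?_ ?_
  · rw [setIntegral_congr_fun hΩ.measurableSet fun x hx => (hdiff ε₀ hε₀ x hx).deriv]
    exact key.2
  · filter_upwards [hs.mem_nhds hε₀] with ε hε
    exact (integrableOn_of_eq_zero_off_compact hΩ hK hKΩ (hcg ε hε) (h0 ε hε)).aestronglyMeasurable
  · exact integrableOn_of_eq_zero_off_compact hΩ hK hKΩ (hcg ε₀ hε₀) (h0 ε₀ hε₀)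
  · refine (integrableOn_of_eq_zero_off_compact hΩ hK hKΩ ?_ (hzero ε₀ hε₀)).aestronglyMeasurable
    exact hcont.comp (Continuous.prodMk_right ε₀).continuousOn fun x hx => ⟨hε₀, hx⟩
  · refine (ae_restrict_mem hΩ.measurableSet).mono fun x hx ε hε => ?_
    by_cases hxK : x ∈ K
    · rw [indicator_of_mem hxK]
      exact hC (ε, x) ⟨hε, hxK⟩
    · rw [indicator_of_notMem hxK, hzero ε (hrs hε) x ⟨hx, hxK⟩, norm_zero]
  · refine ((integrable_indicator_iff hK.measurableSet).2 ?_).integrableOn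
    exact integrableOn_const hK.measure_lt_top.ne
  · exact (ae_restrict_mem hΩ.measurableSet).mono fun x hx ε hε => hdiff ε (hrs hε) x hx

/-- Smooth dependence on parameters of the integral of a function with support in a fixed compact
set. -/
theorem contDiffOn_setIntegral {P : Type*} [NormedAddCommGroup P] [NormedSpace ℝ P]
    {μ : Measure B} [IsFiniteMeasureOnCompacts μ] [SFinite μ] [IsLocallyFiniteMeasure μ]
    [μ.IsAddLeftInvariant]
    {Ω K : Set B} (hΩ : IsOpen Ω) (hK : IsCompact K) (hKΩ : K ⊆ Ω) {s : Set P} (hs : IsOpen s)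
    {g : P → B → ℝ} (hg : ContDiffOn ℝ ∞ (Function.uncurry g) (s ×ˢ Ω))
    (h0 : ∀ p ∈ s, ∀ x ∈ Ω \ K, g p x = 0) :
    ContDiffOn ℝ ∞ (fun p => ∫ x in Ω, g p x ∂μ) s := by
  -- Extension by zero stays smooth: a point outside `Ω` lies in the open complement of `K`, where
  -- `G` vanishes.
  set G : P → B → ℝ := fun p => Ω.indicator (g p) with hG
  have hGsmooth : ContDiffOn ℝ ∞ (Function.uncurry G) (s ×ˢ univ) := by
    rintro ⟨p, x⟩ ⟨hp, -⟩
    by_cases hx : x ∈ Ω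
    · have hmem : s ×ˢ Ω ∈ 𝓝 (p, x) := (hs.prod hΩ).mem_nhds ⟨hp, hx⟩
      refine ((hg.contDiffAt hmem).congr_of_eventuallyEq ?_).contDiffWithinAt
      filter_upwards [hmem] with q hq
      exact indicator_of_mem hq.2 _
    · have hmem : s ×ˢ Kᶜ ∈ 𝓝 (p, x) :=
        (hs.prod hK.isClosed.isOpen_compl).mem_nhds ⟨hp, fun h => hx (hKΩ h)⟩
      refine (contDiffAt_const (c := (0 : ℝ)).congr_of_eventuallyEq ?_).contDiffWithinAt
      filter_upwards [hmem] with q hq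
      by_cases hq' : q.2 ∈ Ω
      · exact (indicator_of_mem hq' _).trans (h0 q.1 hq.1 q.2 ⟨hq', hq.2⟩)
      · exact indicator_of_notMem hq' _
  have hneg : ContDiffOn ℝ ∞ (Function.uncurry fun p x => G p (-x)) (s ×ˢ univ) := by
    refine hGsmooth.comp (g := Function.uncurry G) (f := fun q : P × B => (q.1, -q.2)) ?_ ?_
    · exact (contDiff_fst.prodMk contDiff_snd.neg).contDiffOn
    · exact fun q hq => ⟨hq.1, mem_univ _⟩
  -- The integral is the convolution of the constant `1` with the reflected integrand, evaluated at
  -- the point `0`.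
  have hconv := contDiffOn_convolution_right_with_param (μ := μ) (f := fun _ : B => (1 : ℝ))
    (n := ⊤) (ContinuousLinearMap.mul ℝ ℝ) hs hK.neg (g := fun p x => G p (-x))
    (fun p x hp hx => ?_) (locallyIntegrable_const 1) hneg
  · have hcomp := hconv.comp (f := fun p : P => (p, (0 : B)))
      (contDiff_id.prodMk contDiff_const).contDiffOn (fun p hp => ⟨hp, mem_univ _⟩) (s := s)
    refine hcomp.congr fun p _ => ?_
    simp [convolution, hG, integral_indicator hΩ.measurableSet]
  · by_cases hx' : -x ∈ Ω
    · exact (indicator_of_mem hx' _).trans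
        (h0 p hp (-x) ⟨hx', fun h => hx (Set.mem_neg.2 h)⟩)
    · exact indicator_of_notMem hx' _

end Integrals

/-! ### Iterated derivatives in `x` of maps that depend on a parameter. -/

section Derivatives

variable {Q E F : Type*} [NormedAddCommGroup Q] [NormedSpace ℝ Q] [NormedAddCommGroup E]
  [NormedSpace ℝ E] [NormedAddCommGroup F] [NormedSpace ℝ F]

theorem iteratedFDeriv_succ_eq_curryLeft_symm (j : ℕ) (f : E → F) (x : E) :
    iteratedFDeriv ℝ (j + 1) f x =
      (continuousMultilinearCurryLeftEquiv ℝ (fun _ : Fin (j + 1) => E) F).symm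
        (fderiv ℝ (iteratedFDeriv ℝ j f) x) := by
  rw [iteratedFDeriv_succ_eq_comp_left]
  rfl

theorem contDiffOn_iteratedFDeriv_slice {W : Q → E → F} {O : Set (Q × E)} (hO : IsOpen O)
    (hW : ContDiffOn ℝ ∞ (Function.uncurry W) O) (j : ℕ) :
    ContDiffOn ℝ ∞ (fun z : Q × E => iteratedFDeriv ℝ j (W z.1) z.2) O := by
  induction j with
  | zero =>
    have h := (continuousMultilinearCurryFin0 ℝ E F).symm.contDiff (n := ∞)
    exact h.comp_contDiffOn hW
  | succ j ih =>
    have h : ContDiff ℝ ∞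
        (continuousMultilinearCurryLeftEquiv ℝ (fun _ : Fin (j + 1) => E) F).symm :=
      LinearIsometryEquiv.contDiff _
    simp only [iteratedFDeriv_succ_eq_curryLeft_symm]
    refine h.comp_contDiffOn fun z hz => ContDiffAt.contDiffWithinAt ?_
    refine ContDiffAt.fderiv (f := fun (z : Q × E) => iteratedFDeriv ℝ j (W z.1)) (g := Prod.snd)
      (n := ∞) (m := ∞) ?_ contDiffAt_snd le_rfl
    have h1 := ih.contDiffAt (hO.mem_nhds hz)
    exact ContDiffAt.comp (f := fun y : (Q × E) × E => (y.1.1, y.2)) (z, z.2) h1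
      (contDiffAt_fst.fst.prodMk contDiffAt_snd)

theorem hasDerivAt_slice {W : ℝ → E → F} {t : ℝ} {x : E}
    (hW : DifferentiableAt ℝ (Function.uncurry W) (t, x)) :
    HasDerivAt (fun s => W s x) (fderiv ℝ (Function.uncurry W) (t, x) (1, 0)) t :=
  hW.hasFDerivAt.comp_hasDerivAt (f := fun s : ℝ => (s, x)) t
    ((hasDerivAt_id t).prodMk (hasDerivAt_const t x))

theorem hasFDerivAt_slice {W : Q → E → F} {t : Q} {x : E}
    (hW : DifferentiableAt ℝ (Function.uncurry W) (t, x)) :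
    HasFDerivAt (W t)
      ((fderiv ℝ (Function.uncurry W) (t, x)).comp (ContinuousLinearMap.inr ℝ Q E)) x :=
  hW.hasFDerivAt.comp (f := fun y : E => (t, y)) x (hasFDerivAt_prodMk_right t x)

/-- Symmetry of the second derivative of the uncurried map, applied to the directions `(1, 0)` and
`(0, v)`. -/
theorem hasDerivAt_fderiv_slice {W : ℝ → E → F} {t : ℝ} {x : E}
    (hW : ContDiffAt ℝ ∞ (Function.uncurry W) (t, x)) :
    HasDerivAt (fun s => fderiv ℝ (W s) x)
      (fderiv ℝ (fun y => deriv (fun s => W s y) t) x) t := by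
  set Φ := Function.uncurry W with hΦ
  have hnear : ∀ᶠ z in 𝓝 (t, x), DifferentiableAt ℝ Φ z :=
    ((hW.of_le (m := 1) (by exact_mod_cast le_top)).eventually (by exact_mod_cast ENat.one_ne_top)).mono fun z hz =>
      hz.differentiableAt one_ne_zero
  have hΦ' : HasFDerivAt (fderiv ℝ Φ) (fderiv ℝ (fderiv ℝ Φ) (t, x)) (t, x) :=
    ((hW.fderiv_right (m := ∞) le_rfl).differentiableAt (by simp)).hasFDerivAt
  have hsymm : IsSymmSndFDerivAt ℝ Φ (t, x) := hW.isSymmSndFDerivAt (by simpa using ENat.LEInfty.out)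
  have hleft : HasDerivAt (fun s => fderiv ℝ (W s) x)
      ((fderiv ℝ (fderiv ℝ Φ) (t, x) (1, 0)).comp (ContinuousLinearMap.inr ℝ ℝ E)) t := by
    have h1 : HasDerivAt (fun s : ℝ => fderiv ℝ Φ (s, x)) (fderiv ℝ (fderiv ℝ Φ) (t, x) (1, 0)) t :=
      hΦ'.comp_hasDerivAt (f := fun s : ℝ => (s, x)) t
        ((hasDerivAt_id t).prodMk (hasDerivAt_const t x))
    have h2 := (((ContinuousLinearMap.compL ℝ E (ℝ × E) F).flip
      (ContinuousLinearMap.inr ℝ ℝ E)).hasFDerivAt).comp_hasDerivAt t h1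
    refine h2.congr_of_eventuallyEq ?_
    have hc : Tendsto (fun s : ℝ => (s, x)) (𝓝 t) (𝓝 (t, x)) :=
      (Continuous.prodMk_left x).tendsto t
    filter_upwards [hc.eventually hnear] with s hs
    exact (hasFDerivAt_slice hs).fderiv
  have hright : HasFDerivAt (fun y => deriv (fun s => W s y) t)
      ((fderiv ℝ (fderiv ℝ Φ) (t, x) (1, 0)).comp (ContinuousLinearMap.inr ℝ ℝ E)) x := by
    have h1 : HasFDerivAt (fun y : E => fderiv ℝ Φ (t, y))
        ((fderiv ℝ (fderiv ℝ Φ) (t, x)).comp (ContinuousLinearMap.inr ℝ ℝ E)) x :=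
      hΦ'.comp (f := fun y : E => (t, y)) x (hasFDerivAt_prodMk_right t x)
    have h2 := (h1.clm_apply (hasFDerivAt_const ((1 : ℝ), (0 : E)) x))
    have h3 : HasFDerivAt (fun y => deriv (fun s => W s y) t) _ x :=
      h2.congr_of_eventuallyEq (by
        have hc : Tendsto (fun y : E => (t, y)) (𝓝 x) (𝓝 (t, x)) :=
          (Continuous.prodMk_right t).tendsto x
        filter_upwards [hc.eventually hnear] with y hy
        exact (hasDerivAt_slice hy).deriv)
    refine h3.congr_fderiv ?_
    ext v
    simpa using hsymm (0, v) (1, 0)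
  rw [hright.fderiv]
  exact hleft

/-- By induction, `∂_t` passes through one `x`-derivative at a time. Openness of `O` makes the
inductive identity hold near the point, so that it may be differentiated again. -/
theorem hasDerivAt_iteratedFDeriv_slice {W : ℝ → E → F} {O : Set (ℝ × E)} (hO : IsOpen O)
    (hW : ContDiffOn ℝ ∞ (Function.uncurry W) O) (j : ℕ) :
    ∀ z ∈ O, HasDerivAt (fun s => iteratedFDeriv ℝ j (W s) z.2)
      (iteratedFDeriv ℝ j (fun y => deriv (fun s => W s y) z.1) z.2) z.1 := by
  induction j with
  | zero =>
    intro z hz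
    have h := hasDerivAt_slice ((hW.contDiffAt (hO.mem_nhds hz)).differentiableAt (by simp))
    have h' := h.differentiableAt.hasDerivAt
    exact ((continuousMultilinearCurryFin0 ℝ E F).symm.toContinuousLinearEquiv.hasFDerivAt
      ).comp_hasDerivAt z.1 h'
  | succ j ih =>
    intro z hz
    simp only [iteratedFDeriv_succ_eq_curryLeft_symm]
    have h := hasDerivAt_fderiv_slice (W := fun s => iteratedFDeriv ℝ j (W s)) (t := z.1) (x := z.2)
      ((contDiffOn_iteratedFDeriv_slice hO hW j).contDiffAt (hO.mem_nhds hz))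
    have heq : (fun y => deriv (fun s => iteratedFDeriv ℝ j (W s) y) z.1) =ᶠ[𝓝 z.2]
        iteratedFDeriv ℝ j (fun y => deriv (fun s => W s y) z.1) := by
      have hc : Tendsto (fun y : E => (z.1, y)) (𝓝 z.2) (𝓝 z) :=
        (Continuous.prodMk_right z.1).tendsto z.2
      filter_upwards [hc.eventually (hO.mem_nhds hz)] with y hy
      exact (ih (z.1, y) hy).deriv
    rw [heq.fderiv_eq] at h
    exact ((continuousMultilinearCurryLeftEquiv ℝ (fun _ : Fin (j + 1) => E) F
      ).symm.toContinuousLinearEquiv.hasFDerivAt).comp_hasDerivAt z.1 h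

end Derivatives


/-! ### Jets: smoothness, linearity and dependence on parameters. -/

section Jets

variable {n m k : ℕ}

theorem partialDeriv_eq_clm_apply (α : Fin n → ℕ) (u : (Fin n → ℝ) → (Fin m → ℝ)) (i : Fin m)
    (x : Fin n → ℝ) :
    partialDeriv α u i x = ((ContinuousLinearMap.proj (R := ℝ) (φ := fun _ : Fin m => ℝ) i).comp
      (ContinuousMultilinearMap.apply ℝ (fun _ : Fin (∑ a, α a) => Fin n → ℝ) (Fin m → ℝ)
        (directions α))) (iteratedFDeriv ℝ (∑ a, α a) u x) :=
  rfl

theorem contDiffOn_jet {Q : Type*} [NormedAddCommGroup Q] [NormedSpace ℝ Q]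
    {W : Q → (Fin n → ℝ) → (Fin m → ℝ)} {O : Set (Q × (Fin n → ℝ))} (hO : IsOpen O)
    (hW : ContDiffOn ℝ ∞ (Function.uncurry W) O) :
    ContDiffOn ℝ ∞ (fun z : Q × (Fin n → ℝ) => jet k (W z.1) z.2) O := by
  refine contDiffOn_pi.2 fun i => contDiffOn_pi.2 fun α => ?_
  simp only [jet, partialDeriv_eq_clm_apply]
  exact (ContinuousLinearMap.contDiff _).comp_contDiffOn (contDiffOn_iteratedFDeriv_slice hO hW _)

theorem hasDerivAt_jet {W : ℝ → (Fin n → ℝ) → (Fin m → ℝ)} {O : Set (ℝ × (Fin n → ℝ))}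
    (hO : IsOpen O) (hW : ContDiffOn ℝ ∞ (Function.uncurry W) O) {t : ℝ} {x : Fin n → ℝ}
    (hz : (t, x) ∈ O) :
    HasDerivAt (fun s => jet k (W s) x) (jet k (fun y => deriv (fun s => W s y) t) x) t := by
  refine hasDerivAt_pi.2 fun i => hasDerivAt_pi.2 fun α => ?_
  simp only [jet, partialDeriv_eq_clm_apply]
  exact (ContinuousLinearMap.hasFDerivAt _).comp_hasDerivAt t
    (hasDerivAt_iteratedFDeriv_slice hO hW _ (t, x) hz)

theorem jet_congr {u v : (Fin n → ℝ) → (Fin m → ℝ)} {x : Fin n → ℝ} (h : u =ᶠ[𝓝 x] v) :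
    jet k u x = jet k v x := by
  funext i α
  simp only [jet, partialDeriv]
  rw [(h.iteratedFDeriv ℝ _).eq_of_nhds]

theorem jet_add_smul {u v : (Fin n → ℝ) → (Fin m → ℝ)} {x : Fin n → ℝ} (hu : ContDiffAt ℝ ∞ u x)
    (hv : ContDiffAt ℝ ∞ v x) (c : ℝ) : jet k (u + c • v) x = jet k u x + c • jet k v x := by
  funext i α
  simp only [jet, partialDeriv, Pi.add_apply, Pi.smul_apply]
  have hu' := hu.of_le (m := (∑ a, α.1 a : ℕ)) (by exact_mod_cast le_top)
  have hv' := hv.of_le (m := (∑ a, α.1 a : ℕ)) (by exact_mod_cast le_top)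
  rw [iteratedFDeriv_add_apply hu' (show ContDiffAt ℝ _ (c • v) x from hv'.const_smul c),
    iteratedFDeriv_const_smul_apply hv']
  rfl

/-- This lets `homotopyIntegrand` use the jet of the constant at the point `0`, which need not lie
in `X`. -/
theorem jet_const (c : Fin m → ℝ) (x y : Fin n → ℝ) :
    jet k (fun _ => c) x = jet k (fun _ => c) y := by
  have h : ∀ j : ℕ, iteratedFDeriv ℝ j (fun _ : Fin n → ℝ => c) x =
      iteratedFDeriv ℝ j (fun _ : Fin n → ℝ => c) y := by
    rintro (_ | j)
    · ext; simp
    · simp [iteratedFDeriv_succ_const]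
  funext i α
  simp only [jet, partialDeriv, h]

theorem jet_zeroIndex (u : (Fin n → ℝ) → (Fin m → ℝ)) (x : Fin n → ℝ) (i : Fin m) :
    jet k u x i (zeroIndex n k) = u x i := by
  -- The order is a sum of zeros and the type of `directions` depends on it, so the order is
  -- generalized before it is replaced by `0`.
  have h : ∀ (j : ℕ) (_ : j = 0) (d : Fin j → (Fin n → ℝ)), iteratedFDeriv ℝ j u x d = u x := by
    rintro _ rfl d
    simp
  exact congrFun (h _ (by simp [zeroIndex]) _) i

theorem mem_jetDomain {X : Set (Fin n → ℝ)} {U : Set (Fin m → ℝ)}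
    {u : (Fin n → ℝ) → (Fin m → ℝ)} {x : Fin n → ℝ} :
    (x, jet k u x) ∈ jetDomain k X U ↔ x ∈ X ∧ u x ∈ U := by
  simp only [jetDomain, mem_ofPred_eq, jet_zeroIndex]

theorem isOpen_jetDomain {X : Set (Fin n → ℝ)} {U : Set (Fin m → ℝ)} (hX : IsOpen X)
    (hU : IsOpen U) : IsOpen (jetDomain k X U) := by
  refine (hX.preimage continuous_fst).inter (hU.preimage ?_)
  fun_prop

theorem jetDomain_mono {X : Set (Fin n → ℝ)} {U V : Set (Fin m → ℝ)} (h : V ⊆ U) :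
    jetDomain k X V ⊆ jetDomain k X U :=
  fun _ hq => ⟨hq.1, h hq.2⟩

end Jets

/-! ### Smoothness and locality of the integrands. -/

section Densities

variable {n m k : ℕ}

theorem contDiffOn_lagrangianDensity {Q : Type*} [NormedAddCommGroup Q] [NormedSpace ℝ Q]
    {X : Set (Fin n → ℝ)} {U : Set (Fin m → ℝ)} {L : (Fin n → ℝ) × Jet n m k → ℝ}
    (hL : ContDiffOn ℝ ∞ L (jetDomain k X U))
    {W : Q → (Fin n → ℝ) → (Fin m → ℝ)} {O : Set (Q × (Fin n → ℝ))} (hO : IsOpen O)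
    (hW : ContDiffOn ℝ ∞ (Function.uncurry W) O) (hmem : ∀ z ∈ O, z.2 ∈ X ∧ W z.1 z.2 ∈ U) :
    ContDiffOn ℝ ∞ (fun z : Q × (Fin n → ℝ) => lagrangianDensity L (W z.1) z.2) O :=
  hL.comp (contDiffOn_snd.prodMk (contDiffOn_jet hO hW)) fun z hz => mem_jetDomain.2 (hmem z hz)

theorem lagrangianDensity_congr {L : (Fin n → ℝ) × Jet n m k → ℝ}
    {u v : (Fin n → ℝ) → (Fin m → ℝ)} {x : Fin n → ℝ} (h : u =ᶠ[𝓝 x] v) :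
    lagrangianDensity L u x = lagrangianDensity L v x := by
  rw [lagrangianDensity, jet_congr h, lagrangianDensity]

theorem contDiffOn_extendedDensity {P : Type*} [NormedAddCommGroup P] [NormedSpace ℝ P]
    {X : Set (Fin n → ℝ)} {U : Set (Fin m → ℝ)} {A : Fin m → (Fin n → ℝ) × Jet n m k → ℝ}
    (hA : ∀ i, ContDiffOn ℝ ∞ (A i) (jetDomain k X U))
    {W : P → (Fin n → ℝ) × ℝ → (Fin m → ℝ)} {O : Set (P × ((Fin n → ℝ) × ℝ))} (hO : IsOpen O)
    (hW : ContDiffOn ℝ ∞ (Function.uncurry W) O) (hmem : ∀ z ∈ O, z.2.1 ∈ X ∧ W z.1 z.2 ∈ U) :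
    ContDiffOn ℝ ∞ (fun z : P × ((Fin n → ℝ) × ℝ) => extendedDensity A (W z.1) z.2) O := by
  refine ContDiffOn.sum fun i _ => ContDiffOn.mul ?_ ?_
  · refine fun z hz => ContDiffAt.contDiffWithinAt ?_
    simp only [← fderiv_apply_one_eq_deriv]
    suffices h : ContDiffAt ℝ ∞ (fun z : P × ((Fin n → ℝ) × ℝ) =>
        fderiv ℝ (fun t => W z.1 (z.2.1, t)) z.2.2) z from
      contDiffAt_pi.1 (h.clm_apply contDiffAt_const) i
    refine ContDiffAt.fderiv (f := fun (z : P × ((Fin n → ℝ) × ℝ)) t => W z.1 (z.2.1, t))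
      (g := fun z => z.2.2) (n := ∞) (m := ∞) ?_ contDiffAt_snd.snd le_rfl
    exact ContDiffAt.comp (g := Function.uncurry W)
      (f := fun y : (P × ((Fin n → ℝ) × ℝ)) × ℝ => (y.1.1, (y.1.2.1, y.2))) (z, z.2.2)
      (hW.contDiffAt (hO.mem_nhds hz))
      (contDiffAt_fst.fst.prodMk (contDiffAt_fst.snd.fst.prodMk contDiffAt_snd))
  -- In the factor `A_i` only `x` is differentiated, so `t` joins the parameters and the factor is a
  -- Lagrangian density.
  · have hc : ContDiff ℝ ∞ fun y : (P × ℝ) × (Fin n → ℝ) => (y.1.1, (y.2, y.1.2)) :=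
      contDiff_fst.fst.prodMk (contDiff_snd.prodMk contDiff_fst.snd)
    have h := contDiffOn_lagrangianDensity (Q := P × ℝ) (hA i)
      (W := fun p x => W p.1 (x, p.2))
      (O := (fun y : (P × ℝ) × (Fin n → ℝ) => (y.1.1, (y.2, y.1.2))) ⁻¹' O)
      (hO.preimage hc.continuous)
      (hW.comp hc.contDiffOn fun _ hz => hz) fun z hz => hmem _ hz
    have hc' : ContDiff ℝ ∞ fun z : P × ((Fin n → ℝ) × ℝ) => ((z.1, z.2.2), z.2.1) :=
      (contDiff_fst.prodMk contDiff_snd.snd).prodMk contDiff_snd.fst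
    exact h.comp hc'.contDiffOn fun z hz => hz

theorem IsSection.continuousOn_extendedDensity {X : Set (Fin n → ℝ)} {U : Set (Fin m → ℝ)}
    {A : Fin m → (Fin n → ℝ) × Jet n m k → ℝ} (hX : IsOpen X)
    (hA : ∀ i, ContDiffOn ℝ ∞ (A i) (jetDomain k X U)) {w : (Fin n → ℝ) × ℝ → (Fin m → ℝ)}
    (hw : IsSection (X ×ˢ univ) U w) : ContinuousOn (extendedDensity A w) (X ×ˢ univ) := by
  have hsm : ContDiffOn ℝ ∞ (Function.uncurry fun _ : ℝ => w) (univ ×ˢ (X ×ˢ univ)) :=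
    hw.smooth.comp contDiffOn_snd fun z hz => hz.2
  have h := (contDiffOn_extendedDensity hA (isOpen_univ.prod (hX.prod isOpen_univ)) hsm
    fun z hz => ⟨hz.2.1, hw.mapsTo hz.2⟩).continuousOn
  exact h.comp (Continuous.prodMk_right (0 : ℝ)).continuousOn fun q hq => ⟨mem_univ _, hq⟩

theorem extendedDensity_congr {A : Fin m → (Fin n → ℝ) × Jet n m k → ℝ}
    {u v : (Fin n → ℝ) × ℝ → (Fin m → ℝ)} {q : (Fin n → ℝ) × ℝ} (h : u =ᶠ[𝓝 q] v) :
    extendedDensity A u q = extendedDensity A v q := by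
  have h1 : (fun t => u (q.1, t)) =ᶠ[𝓝 q.2] fun t => v (q.1, t) :=
    ((Continuous.prodMk_right q.1).tendsto q.2).eventually h
  have h2 : (fun x => u (x, q.2)) =ᶠ[𝓝 q.1] fun x => v (x, q.2) :=
    ((Continuous.prodMk_left q.2).tendsto q.1).eventually h
  simp only [extendedDensity, h1.deriv_eq, jet_congr h2]

end Densities

/-! ### Small deformations of sections, and localization of variations. -/

section Variations

variable {B F : Type*} [NormedAddCommGroup B] [NormedAddCommGroup F]

/-- Only the values on the compact set `K` move with the parameter, so the open condition persists
uniformly near `p₀`. -/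
theorem exists_isOpen_forall_mem {P : Type*} [TopologicalSpace P] {Ω K : Set B} (hΩ : IsOpen Ω)
    (hK : IsCompact K) (hKΩ : K ⊆ Ω) {U : Set F} (hU : IsOpen U) {W : P → B → F} {p₀ : P}
    (hW : ContinuousOn (Function.uncurry W) (univ ×ˢ Ω)) (hp₀ : MapsTo (W p₀) Ω U)
    (h0 : ∀ p, ∀ x ∈ Ω \ K, W p x = W p₀ x) :
    ∃ s : Set P, IsOpen s ∧ p₀ ∈ s ∧ ∀ p ∈ s, ∀ x ∈ Ω, W p x ∈ U := by
  have h : ∀ᶠ p in 𝓝 p₀, ∀ x ∈ K, W p x ∈ U := by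
    refine hK.eventually_forall_of_forall_eventually fun x hx => ?_
    have hc : ContinuousAt (Function.uncurry W) (p₀, x) :=
      hW.continuousAt ((isOpen_univ.prod hΩ).mem_nhds ⟨mem_univ _, hKΩ hx⟩)
    exact hc.eventually (hU.mem_nhds (hp₀ (hKΩ hx)))
  obtain ⟨s, hs, hso, hps⟩ := eventually_nhds_iff.1 h
  refine ⟨s, hso, hps, fun p hp x hx => ?_⟩
  by_cases hxK : x ∈ K
  · exact hs p hp x hxK
  · rw [h0 p x ⟨hx, hxK⟩]
    exact hp₀ hx

theorem eventuallyEq_zero_of_notMem_tsupport {η : B → F} {x : B} (hx : x ∉ tsupport η) :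
    η =ᶠ[𝓝 x] 0 :=
  notMem_tsupport_iff_eventuallyEq.1 hx

variable [NormedSpace ℝ B] [NormedSpace ℝ F]

theorem IsTestVariation.add {Ω : Set B} {η₁ η₂ : B → F} (h₁ : IsTestVariation Ω η₁)
    (h₂ : IsTestVariation Ω η₂) : IsTestVariation Ω (η₁ + η₂) :=
  ⟨h₁.smooth.add h₂.smooth, h₁.compact.add h₂.compact,
    (tsupport_add _ _).trans (union_subset h₁.support_subset h₂.support_subset)⟩

theorem IsTestVariation.smul {Ω : Set B} {f : B → ℝ} {η : B → F} (hf : ContDiff ℝ ∞ f)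
    (h : IsTestVariation Ω η) : IsTestVariation Ω (fun x => f x • η x) :=
  ⟨hf.smul h.smooth, h.compact.smul_left,
    (closure_mono fun x hx => by
      contrapose! hx
      simp [Function.notMem_support.1 hx]).trans h.support_subset⟩

/-- A property of test variations that is local and additive holds for all of them. -/
theorem IsTestVariation.induction_on [FiniteDimensional ℝ B] {Ω : Set B} {p : (B → F) → Prop}
    (zero : p 0)
    (add : ∀ η₁ η₂, IsTestVariation Ω η₁ → IsTestVariation Ω η₂ → p η₁ → p η₂ → p (η₁ + η₂))
    (local_mem : ∀ x ∈ Ω, ∃ N, IsOpen N ∧ x ∈ N ∧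
      ∀ η, IsTestVariation Ω η → tsupport η ⊆ N → p η)
    {η : B → F} (hη : IsTestVariation Ω η) : p η := by
  choose! N hNo hxN hN using local_mem
  have hcompact : IsCompact (tsupport η) := hη.compact
  obtain ⟨t, ht⟩ := hcompact.elim_finite_subcover (fun x : Ω => N x) (fun x => hNo x x.2)
    fun x hx => mem_iUnion.2 ⟨⟨x, hη.support_subset hx⟩, hxN x (hη.support_subset hx)⟩
  obtain ⟨f, hf⟩ := SmoothPartitionOfUnity.exists_isSubordinate (modelWithCornersSelf ℝ B)
    (s := tsupport η) (isClosed_tsupport η) (fun i : t => N i.1) (fun i => hNo _ i.1.2)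
    (ht.trans (by
      intro x hx
      simp only [mem_iUnion] at hx ⊢
      obtain ⟨i, hi, hx⟩ := hx
      exact ⟨⟨i, hi⟩, hx⟩))
  have hsmooth : ∀ i, ContDiff ℝ ∞ (f i) := fun i => (f i).contMDiff.contDiff
  have hpart : ∀ i, IsTestVariation Ω fun x => f i x • η x := fun i => hη.smul (hsmooth i)
  have hsum : ∀ T : Finset t, IsTestVariation Ω (∑ i ∈ T, fun x => f i x • η x) ∧
      p (∑ i ∈ T, fun x => f i x • η x) := by
    classical
    intro T
    induction T using Finset.induction_on with
    | empty =>
      refine ⟨⟨contDiff_const, HasCompactSupport.zero, ?_⟩, zero⟩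
      rw [Finset.sum_empty]
      simp [tsupport]
    | insert i T hi ih =>
      rw [Finset.sum_insert hi]
      refine ⟨(hpart i).add ih.1, add _ _ (hpart i) ih.1 ?_ ih.2⟩
      refine hN i.1 i.1.2 _ (hpart i) (Subset.trans ?_ (hf i))
      refine closure_mono fun x hx => ?_
      contrapose! hx
      simp [Function.notMem_support.1 hx]
  have heq : η = ∑ i, fun x => f i x • η x := by
    funext x
    rw [Finset.sum_apply, ← Finset.sum_smul]
    by_cases hx : x ∈ tsupport η
    · rw [← finsum_eq_sum_of_fintype, f.sum_eq_one hx, one_smul]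
    · rw [image_eq_zero_of_notMem_tsupport hx, smul_zero]
  rw [heq]
  exact (hsum Finset.univ).2

end Variations

/-! ### Additivity of the variation of `∫ u̇^i A_i dⁿx dt`. -/

section ExtendedFunctional

variable {n m k : ℕ} {X : Set (Fin n → ℝ)} {U : Set (Fin m → ℝ)}
  {A : Fin m → (Fin n → ℝ) × Jet n m k → ℝ}

/-- Translation invariance is needed for the convolution argument in `contDiffOn_setIntegral`. -/
instance : (volume : Measure ((Fin n → ℝ) × ℝ)).IsAddLeftInvariant :=
  inferInstanceAs ((volume : Measure (Fin n → ℝ)).prod (volume : Measure ℝ)).IsAddLeftInvariant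

/-- Directional derivatives alone need not add. Here the functional at `u + a η₁ + b η₂` is smooth
in `(a, b)` near `0`, so its directional derivatives come from one linear map `G`. -/
theorem hasVariation_extendedDensity_add (hX : IsOpen X) (hU : IsOpen U)
    (hA : ∀ i, ContDiffOn ℝ ∞ (A i) (jetDomain k X U)) {u η₁ η₂ : (Fin n → ℝ) × ℝ → (Fin m → ℝ)}
    (hu : IsSection (X ×ˢ univ) U u) (hη₁ : IsTestVariation (X ×ˢ univ) η₁)
    (hη₂ : IsTestVariation (X ×ˢ univ) η₂)
    (h₁ : HasVariation (X ×ˢ univ) (extendedDensity A) u η₁ 0)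
    (h₂ : HasVariation (X ×ˢ univ) (extendedDensity A) u η₂ 0) :
    HasVariation (X ×ˢ univ) (extendedDensity A) u (η₁ + η₂) 0 := by
  have hΩ : IsOpen (X ×ˢ (univ : Set ℝ)) := hX.prod isOpen_univ
  have hK : IsCompact (tsupport η₁ ∪ tsupport η₂) := hη₁.compact.isCompact.union hη₂.compact
  have hKΩ : tsupport η₁ ∪ tsupport η₂ ⊆ X ×ˢ univ :=
    union_subset hη₁.support_subset hη₂.support_subset
  set W : ℝ × ℝ → (Fin n → ℝ) × ℝ → (Fin m → ℝ) := fun p => u + p.1 • η₁ + p.2 • η₂ with hW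
  have hWs : ContDiffOn ℝ ∞ (Function.uncurry W) (univ ×ˢ (X ×ˢ univ)) := by
    refine ((hu.smooth.comp contDiffOn_snd fun z hz => hz.2).add ?_).add ?_
    · exact (contDiff_fst.fst.smul (hη₁.smooth.comp contDiff_snd)).contDiffOn
    · exact (contDiff_fst.snd.smul (hη₂.smooth.comp contDiff_snd)).contDiffOn
  have hoff : ∀ p, ∀ x ∉ tsupport η₁ ∪ tsupport η₂, W p =ᶠ[𝓝 x] u := by
    intro p x hx
    rw [mem_union, not_or] at hx
    filter_upwards [eventuallyEq_zero_of_notMem_tsupport hx.1,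
      eventuallyEq_zero_of_notMem_tsupport hx.2] with y hy1 hy2
    simp [hW, hy1, hy2]
  have hW0 : W 0 = u := by simp [hW]
  obtain ⟨s, hs, hs0, hsU⟩ := exists_isOpen_forall_mem hΩ hK hKΩ hU hWs.continuousOn
    (p₀ := 0) (by rw [hW0]; exact hu.mapsTo)
    (fun p x hx => by rw [hW0]; exact (hoff p x hx.2).eq_of_nhds)
  have hsm : ContDiffOn ℝ ∞
      (fun p => ∫ q in X ×ˢ univ, (extendedDensity A (W p) q - extendedDensity A u q)) s := by
    refine contDiffOn_setIntegral hΩ hK hKΩ hs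
      (g := fun p q => extendedDensity A (W p) q - extendedDensity A u q) ?_ ?_
    · refine ContDiffOn.sub ?_ ?_
      · exact contDiffOn_extendedDensity hA (hs.prod hΩ) (hWs.mono (prod_mono (subset_univ _) le_rfl))
          fun z hz => ⟨hz.2.1, hsU z.1 hz.1 z.2 hz.2⟩
      · exact contDiffOn_extendedDensity hA (W := fun _ : ℝ × ℝ => u) (hs.prod hΩ)
          (hu.smooth.comp contDiffOn_snd fun z hz => hz.2) fun z hz => ⟨hz.2.1, hu.mapsTo hz.2⟩
    · intro p _ x hx
      rw [extendedDensity_congr (hoff p x hx.2), sub_self]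
  have hd := ((hsm.contDiffAt (hs.mem_nhds hs0)).differentiableAt (by simp)).hasFDerivAt
  set G := fderiv ℝ
    (fun p => ∫ q in X ×ˢ univ, (extendedDensity A (W p) q - extendedDensity A u q)) 0 with hG
  have hline : ∀ a b : ℝ, HasDerivAt (fun ε : ℝ => ∫ q in X ×ˢ univ,
      (extendedDensity A (W (ε * a, ε * b)) q - extendedDensity A u q)) (G (a, b)) 0 := by
    intro a b
    have hl : HasDerivAt (fun ε : ℝ => (ε * a, ε * b)) (a, b) 0 := by
      simpa using ((hasDerivAt_id (0 : ℝ)).mul_const a).prodMk ((hasDerivAt_id (0 : ℝ)).mul_const b)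
    exact HasFDerivAt.comp_hasDerivAt_of_eq (0 : ℝ) hd hl (by simp [Prod.mk_zero_zero])
  have hG1 : G (1, 0) = 0 := by
    refine (hline 1 0).unique ?_
    simpa [hW, HasVariation] using h₁
  have hG2 : G (0, 1) = 0 := by
    refine (hline 0 1).unique ?_
    simpa [hW, HasVariation] using h₂
  have hG3 : G (1, 1) = 0 := by
    have : ((1 : ℝ), (1 : ℝ)) = (1, 0) + (0, 1) := by simp
    rw [this, map_add, hG1, hG2, add_zero]
  have h := hline 1 1
  rw [hG3] at h
  simpa [hW, HasVariation, add_assoc] using h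

end ExtendedFunctional


/-! ### From a local Lagrangian to vanishing variation. -/

section Exactness

variable {n m k l : ℕ} {X : Set (Fin n → ℝ)} {U V : Set (Fin m → ℝ)}
  {A : Fin m → (Fin n → ℝ) × Jet n m k → ℝ} {L : (Fin n → ℝ) × Jet n m l → ℝ}

theorem volume_restrict_prod_univ (X : Set (Fin n → ℝ)) :
    (volume : Measure ((Fin n → ℝ) × ℝ)).restrict (X ×ˢ univ) =
      ((volume : Measure (Fin n → ℝ)).restrict X).prod (volume : Measure ℝ) := by
  rw [Measure.volume_eq_prod, ← Measure.prod_restrict, Measure.restrict_univ]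

theorem hasDerivAt_lagrangianDensity (hX : IsOpen X) (hV : IsOpen V)
    (hL : ContDiffOn ℝ ∞ L (jetDomain l X V)) {W : ℝ → (Fin n → ℝ) → (Fin m → ℝ)}
    {O : Set (ℝ × (Fin n → ℝ))} (hO : IsOpen O) (hW : ContDiffOn ℝ ∞ (Function.uncurry W) O)
    {t : ℝ} {x : Fin n → ℝ} (hz : (t, x) ∈ O) (hx : x ∈ X) (hV' : W t x ∈ V) :
    HasDerivAt (fun s => lagrangianDensity L (W s) x)
      (fderiv ℝ L (x, jet l (W t) x) (0, jet l (fun y => deriv (fun s => W s y) t) x)) t := by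
  have hd : DifferentiableAt ℝ L (x, jet l (W t) x) :=
    (hL.contDiffAt ((isOpen_jetDomain hX hV).mem_nhds
      (mem_jetDomain.2 ⟨hx, hV'⟩))).differentiableAt (by simp)
  exact hd.hasFDerivAt.comp_hasDerivAt t ((hasDerivAt_const t x).prodMk (hasDerivAt_jet hO hW hz))

/-- A compactly supported deformation of a constant section is a closed path of sections: the
integral over it of the differential of a functional vanishes. -/
theorem IsVariationalDerivative.setIntegral_extendedDensity_eq_zero (hX : IsOpen X) (hV : IsOpen V)
    (hA : ∀ i, ContDiffOn ℝ ∞ (A i) (jetDomain k X V)) (hL : ContDiffOn ℝ ∞ L (jetDomain l X V))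
    (hLA : IsVariationalDerivative X V L A) {u₀ : Fin m → ℝ} {w : (Fin n → ℝ) × ℝ → (Fin m → ℝ)}
    (hw : ContDiff ℝ ∞ w) {K : Set ((Fin n → ℝ) × ℝ)} (hK : IsCompact K) (hKX : K ⊆ X ×ˢ univ)
    (hwK : ∀ q ∉ K, w q = u₀) (hwV : ∀ q, w q ∈ V) :
    IntegrableOn (extendedDensity A w) (X ×ˢ univ) ∧
      ∫ q in X ×ˢ univ, extendedDensity A w q = 0 := by
  have hΩ : IsOpen (X ×ˢ (univ : Set ℝ)) := hX.prod isOpen_univ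
  have hnear : ∀ q ∉ K, w =ᶠ[𝓝 q] fun _ => u₀ := fun q hq => by
    filter_upwards [hK.isClosed.isOpen_compl.mem_nhds hq] with y hy using hwK y hy
  have hint : IntegrableOn (extendedDensity A w) (X ×ˢ univ) := by
    have hsec : IsSection (X ×ˢ univ) V w := ⟨hw.contDiffOn, fun q _ => hwV q⟩
    refine integrableOn_of_eq_zero_off_compact hΩ hK hKX
      (hsec.continuousOn_extendedDensity hX hA) fun q hq => ?_
    rw [extendedDensity_congr (hnear q hq.2)]
    simp [extendedDensity]
  refine ⟨hint, ?_⟩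
  set K₁ : Set (Fin n → ℝ) := Prod.fst '' K with hK₁
  have hK₁c : IsCompact K₁ := hK.image continuous_fst
  have hK₁X : K₁ ⊆ X := by
    rintro _ ⟨q, hq, rfl⟩
    exact (hKX hq).1
  have hslice : ContDiff ℝ ∞ (Function.uncurry fun (t : ℝ) (x : Fin n → ℝ) => w (x, t)) :=
    hw.comp (contDiff_snd.prodMk contDiff_fst)
  have hnear₁ : ∀ t, ∀ x ∉ K₁, (fun y => w (y, t)) =ᶠ[𝓝 x] fun _ => u₀ := fun t x hx => by
    filter_upwards [hK₁c.isClosed.isOpen_compl.mem_nhds hx] with y hy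
    exact hwK _ fun h => hy ⟨_, h, rfl⟩
  set g : ℝ → ℝ := fun t => ∫ x in X, (lagrangianDensity L (fun y => w (y, t)) x -
    lagrangianDensity L (fun _ => u₀) x) with hg
  have hsec : ∀ t, IsSection X V fun x => w (x, t) := fun t =>
    ⟨(hw.comp (contDiff_id.prodMk contDiff_const)).contDiffOn, fun x _ => hwV _⟩
  -- The hypothesis on `L` concerns only straight families. The path `s ↦ w(·, s)` and the line `ε ↦
  -- w(·, t) + ε η` with `η = ∂_t w` have the same first-order jet data, so the functional has the
  -- same derivative along both.
  have hdg : ∀ t, HasDerivAt g (∫ x in X, extendedDensity A w (x, t)) t := by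
    intro t
    set η : (Fin n → ℝ) → (Fin m → ℝ) := fun x => deriv (fun s => w (x, s)) t with hη
    have hηK : ∀ x ∉ K₁, η x = 0 := fun x hx => by
      have : (fun s => w (x, s)) = fun _ => u₀ := funext fun s => hwK _ fun h => hx ⟨_, h, rfl⟩
      simp only [hη, this, deriv_const]
    have hηs : ContDiff ℝ ∞ η := by
      have h : η = fun x => fderiv ℝ (fun s => w (x, s)) t 1 :=
        funext fun x => fderiv_apply_one_eq_deriv.symm
      rw [h]
      exact (ContDiff.fderiv (f := fun x s => w (x, s)) (g := fun _ => t) (n := ∞) (m := ∞) hw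
        contDiff_const le_rfl).clm_apply contDiff_const
    have hηsupp : Function.support η ⊆ K₁ := fun x hx => by
      by_contra h
      exact hx (hηK x h)
    have hηtest : IsTestVariation X η :=
      ⟨hηs, HasCompactSupport.of_support_subset_isCompact hK₁c hηsupp,
        (closure_minimal hηsupp hK₁c.isClosed).trans hK₁X⟩
    set W : ℝ → (Fin n → ℝ) → (Fin m → ℝ) := fun ε => (fun x => w (x, t)) + ε • η with hW
    have hWs : ContDiff ℝ ∞ (Function.uncurry W) :=
      (hw.comp (contDiff_snd.prodMk contDiff_const)).add (contDiff_fst.smul (hηs.comp contDiff_snd))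
    have hW0 : W 0 = fun x => w (x, t) := by simp [hW]
    have hWK : ∀ ε, ∀ x ∉ K₁, W ε =ᶠ[𝓝 x] fun x => w (x, t) := fun ε x hx => by
      filter_upwards [hK₁c.isClosed.isOpen_compl.mem_nhds hx] with y hy
      simp [hW, hηK y hy]
    obtain ⟨s, hs, hs0, hsV⟩ := exists_isOpen_forall_mem hX hK₁c hK₁X hV hWs.continuous.continuousOn
      (p₀ := 0) (by rw [hW0]; exact (hsec t).mapsTo)
      (fun p x hx => by rw [hW0]; exact (hWK p x hx.2).eq_of_nhds)
    have h1 := hasDerivAt_setIntegral (μ := volume) hX hK₁c hK₁X isOpen_univ (mem_univ t)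
      (g := fun t x => lagrangianDensity L (fun y => w (y, t)) x -
        lagrangianDensity L (fun _ => u₀) x)
      (by
        refine ContDiffOn.sub ?_ ?_
        · exact contDiffOn_lagrangianDensity hL (isOpen_univ.prod hX) hslice.contDiffOn
            fun z hz => ⟨hz.2, hwV _⟩
        -- Since `w = u₀` off `K`, a point off `K` shows `u₀ ∈ V`. Such a point exists, since
        -- otherwise `ℝ` would be compact.
        · by_cases hne : ∃ q, q ∉ K
          · obtain ⟨q, hq⟩ := hne
            exact contDiffOn_lagrangianDensity hL (W := fun _ _ => u₀) (isOpen_univ.prod hX)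
              contDiffOn_const fun z hz => ⟨hz.2, hwK q hq ▸ hwV q⟩
          · push Not at hne
            have : (univ : Set ℝ) ⊆ Prod.snd '' K := fun s _ => ⟨((0 : Fin n → ℝ), s), hne _, rfl⟩
            exact absurd ((hK.image continuous_snd).of_isClosed_subset isClosed_univ this)
              (noncompact_univ ℝ))
      (fun ε _ x hx => by rw [lagrangianDensity_congr (hnear₁ ε x hx.2), sub_self])
    have h2 := hasDerivAt_setIntegral (μ := volume) hX hK₁c hK₁X hs hs0
      (g := fun ε x => lagrangianDensity L (W ε) x - lagrangianDensity L (fun x => w (x, t)) x)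
      (by
        refine ContDiffOn.sub ?_ ?_
        · exact contDiffOn_lagrangianDensity hL (hs.prod hX) hWs.contDiffOn
            fun z hz => ⟨hz.2, hsV _ hz.1 _ hz.2⟩
        · exact contDiffOn_lagrangianDensity hL (W := fun _ x => w (x, t)) (hs.prod hX)
            (hw.comp (contDiff_snd.prodMk contDiff_const)).contDiffOn fun z hz => ⟨hz.2, hwV _⟩)
      (fun ε _ x hx => by rw [lagrangianDensity_congr (hWK ε x hx.2), sub_self])
    have h3 := h2.unique (hLA _ η (hsec t) hηtest)
    change _ = ∫ x in X, extendedDensity A w (x, t) at h3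
    rw [← h3]
    convert! h1 using 1
    refine setIntegral_congr_fun hX.measurableSet fun x hx => ?_
    have e1 := (hasDerivAt_lagrangianDensity hX hV hL isOpen_univ hslice.contDiffOn (mem_univ (t, x))
      hx (hwV _)).sub_const (lagrangianDensity L (fun _ => u₀) x)
    have e2 := (hasDerivAt_lagrangianDensity hX hV hL isOpen_univ hWs.contDiffOn
      (mem_univ ((0 : ℝ), x)) hx (hsV 0 hs0 x hx)).sub_const
        (lagrangianDensity L (fun x => w (x, t)) x)
    refine e2.deriv.trans (Eq.trans ?_ e1.deriv.symm)
    have e3 : (fun y => deriv (fun s => W s y) 0) = η := funext fun y => by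
      have : HasDerivAt (fun s : ℝ => w (y, t) + s • η y) ((1 : ℝ) • η y) 0 :=
        ((hasDerivAt_id (0 : ℝ)).smul_const (η y)).const_add _
      rw [one_smul] at this
      exact this.deriv
    rw [e3, hW0]
  have hprod : Integrable (extendedDensity A w)
      (((volume : Measure (Fin n → ℝ)).restrict X).prod (volume : Measure ℝ)) := by
    rw [← volume_restrict_prod_univ]
    exact hint
  rw [volume_restrict_prod_univ, integral_prod_symm _ hprod]
  refine integral_eq_zero_of_hasDerivAt_of_integrable hdg hprod.integral_prod_right ?_
  -- At times outside the projection of `K` the slice of `w` is the constant `u₀`, so `g` vanishes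
  -- there: this is where the path closes up.
  refine Continuous.integrable_of_hasCompactSupport
    (continuous_iff_continuousAt.2 fun t => (hdg t).continuousAt)
    (HasCompactSupport.intro (hK.image continuous_snd) fun t ht => ?_)
  have : (fun y => w (y, t)) = fun _ => u₀ := funext fun y => hwK _ fun h => ht ⟨_, h, rfl⟩
  simp [hg, this]

/-- Near `q₀` the section agrees with a cut-off `w` that is constant far away and stays in `V`. The
change of the functional under `εη` is then a difference of two integrals over closed paths, so it
is exactly zero for small `ε`. -/
theorem IsLocallyVariational.exists_nhds_hasVariation (hX : IsOpen X)
    (hA : ∀ i, ContDiffOn ℝ ∞ (A i) (jetDomain k X U)) (h : IsLocallyVariational X U A)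
    {u : (Fin n → ℝ) × ℝ → (Fin m → ℝ)} (hu : IsSection (X ×ˢ univ) U u)
    {q₀ : (Fin n → ℝ) × ℝ} (hq₀ : q₀ ∈ X ×ˢ (univ : Set ℝ)) :
    ∃ N, IsOpen N ∧ q₀ ∈ N ∧ ∀ η, IsTestVariation (X ×ˢ univ) η → tsupport η ⊆ N →
      HasVariation (X ×ˢ univ) (extendedDensity A) u η 0 := by
  have hΩ : IsOpen (X ×ˢ (univ : Set ℝ)) := hX.prod isOpen_univ
  obtain ⟨V, hV, huV, hVU, l, L, hL, hLA⟩ := h (u q₀) (hu.mapsTo hq₀)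
  obtain ⟨r, hr, hrV⟩ := Metric.isOpen_iff.1 hV (u q₀) huV
  have hcont : ContinuousAt u q₀ := (hu.smooth.contDiffAt (hΩ.mem_nhds hq₀)).continuousAt
  obtain ⟨R, hR, hRN⟩ := Metric.nhds_basis_closedBall.mem_iff.1
    (inter_mem (hΩ.mem_nhds hq₀) (hcont (Metric.ball_mem_nhds (u q₀) hr)))
  let χ : ContDiffBump q₀ := ⟨R / 2, R, half_pos hR, half_lt_self hR⟩
  -- Each value lies on the segment from `u q₀` to `u q`, hence in a ball inside `V` wherever `χ` is
  -- nonzero. On the ball of radius `R / 2`, where `η` will live, `w = u`.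
  set w : (Fin n → ℝ) × ℝ → (Fin m → ℝ) := fun q => u q₀ + χ q • (u q - u q₀) with hw
  have hχK : ∀ q ∉ Metric.closedBall q₀ R, χ q = 0 := fun q hq =>
    image_eq_zero_of_notMem_tsupport (by rw [χ.tsupport_eq]; exact hq)
  have hws : ContDiff ℝ ∞ w := by
    refine contDiff_iff_contDiffAt.2 fun q => ?_
    by_cases hq : q ∈ Metric.closedBall q₀ R
    · exact contDiffAt_const.add (χ.contDiff.contDiffAt.smul
        ((hu.smooth.contDiffAt (hΩ.mem_nhds (hRN hq).1)).sub contDiffAt_const))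
    · refine (contDiffAt_const (c := u q₀)).congr_of_eventuallyEq ?_
      filter_upwards [Metric.isClosed_closedBall.isOpen_compl.mem_nhds hq] with y hy
      simp [hw, hχK y hy]
  have hwK : ∀ q ∉ Metric.closedBall q₀ R, w q = u q₀ := fun q hq => by simp [hw, hχK q hq]
  have hwV : ∀ q, w q ∈ V := by
    intro q
    by_cases hq : q ∈ Metric.closedBall q₀ R
    · refine hrV ?_
      have hb : u q ∈ Metric.ball (u q₀) r := (hRN hq).2
      rw [mem_ball_iff_norm] at hb ⊢
      have h1 : ‖χ q‖ ≤ 1 := by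
        rw [Real.norm_of_nonneg χ.nonneg]
        exact χ.le_one
      calc ‖w q - u q₀‖ = ‖χ q‖ * ‖u q - u q₀‖ := by simp [hw, norm_smul]
        _ ≤ 1 * ‖u q - u q₀‖ := by gcongr
        _ < r := by simpa using hb
    · rw [hwK q hq]
      exact huV
  have hAV : ∀ i, ContDiffOn ℝ ∞ (A i) (jetDomain k X V) := fun i =>
    (hA i).mono (jetDomain_mono hVU)
  have hRX : Metric.closedBall q₀ R ⊆ X ×ˢ univ := fun q hq => (hRN hq).1
  refine ⟨Metric.ball q₀ (R / 2), Metric.isOpen_ball, Metric.mem_ball_self (half_pos hR),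
    fun η hη hηN => ?_⟩
  have hηR : tsupport η ⊆ Metric.closedBall q₀ R := hηN.trans
    ((Metric.ball_subset_ball (half_lt_self hR).le).trans Metric.ball_subset_closedBall)
  have heq : ∀ (ε : ℝ) (q : (Fin n → ℝ) × ℝ),
      extendedDensity A (u + ε • η) q - extendedDensity A u q =
        extendedDensity A (w + ε • η) q - extendedDensity A w q := by
    intro ε q
    by_cases hq : q ∈ tsupport η
    · have huw : u =ᶠ[𝓝 q] w := by
        filter_upwards [Metric.isOpen_ball.mem_nhds (hηN hq)] with y hy
        have : χ y = 1 := χ.one_of_mem_closedBall (Metric.ball_subset_closedBall hy)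
        simp [hw, this]
      rw [extendedDensity_congr huw, extendedDensity_congr (huw.add (EventuallyEq.refl _ (ε • η)))]
    · have h0 := eventuallyEq_zero_of_notMem_tsupport hq
      have hz : ∀ v : (Fin n → ℝ) × ℝ → (Fin m → ℝ), v + ε • η =ᶠ[𝓝 q] v := fun v => by
        filter_upwards [h0] with y hy
        simp [hy]
      rw [extendedDensity_congr (hz u), extendedDensity_congr (hz w), sub_self, sub_self]
  have hT := hLA.setIntegral_extendedDensity_eq_zero hX hV hAV hL hws
    (isCompact_closedBall q₀ R) hRX hwK hwV
  obtain ⟨s, hs, hs0, hsV⟩ := exists_isOpen_forall_mem hΩ (isCompact_closedBall q₀ R) hRX hV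
    (W := fun ε : ℝ => w + ε • η) (p₀ := 0)
    ((hws.continuous.comp continuous_snd).add
      (continuous_fst.smul (hη.smooth.continuous.comp continuous_snd))).continuousOn
    (fun q _ => by simpa using hwV q)
    (fun p q hq => by simp [image_eq_zero_of_notMem_tsupport fun hh => hq.2 (hηR hh)])
  refine (hasDerivAt_const (0 : ℝ) (0 : ℝ)).congr_of_eventuallyEq ?_
  filter_upwards [hs.mem_nhds hs0] with ε hε
  simp only [heq]
  have hoff : ∀ q ∉ Metric.closedBall q₀ R, (w + ε • η) q = u q₀ := fun q hq => by
    simp [image_eq_zero_of_notMem_tsupport fun hh => hq (hηR hh), hwK q hq]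
  have hTε := hLA.setIntegral_extendedDensity_eq_zero hX hV hAV hL (w := w + ε • η)
    (hws.add (contDiff_const.smul hη.smooth)) (isCompact_closedBall q₀ R) hRX hoff fun q => by
      by_cases hq : q ∈ X ×ˢ (univ : Set ℝ)
      · exact hsV ε hε q hq
      · rw [hoff q fun hh => hq (hRX hh)]
        exact huV
  rw [integral_sub hTε.1 hT.1, hTε.2, hT.2, sub_zero]

theorem IsLocallyVariational.hasVariation_extendedDensity (hX : IsOpen X) (hU : IsOpen U)
    (hA : ∀ i, ContDiffOn ℝ ∞ (A i) (jetDomain k X U)) (h : IsLocallyVariational X U A)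
    {u η : (Fin n → ℝ) × ℝ → (Fin m → ℝ)} (hu : IsSection (X ×ˢ univ) U u)
    (hη : IsTestVariation (X ×ˢ univ) η) :
    HasVariation (X ×ˢ univ) (extendedDensity A) u η 0 :=
  hη.induction_on (p := fun η => HasVariation (X ×ˢ univ) (extendedDensity A) u η 0)
    (by simpa [HasVariation] using hasDerivAt_const (0 : ℝ) (0 : ℝ))
    (fun _ _ h₁ h₂ => hasVariation_extendedDensity_add hX hU hA hu h₁ h₂)
    (fun _ hq => h.exists_nhds_hasVariation hX hA hu hq)

end Exactness


/-! ### The smooth step used to parametrize paths. -/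

section SmoothStep

theorem contDiff_deriv_smoothTransition : ContDiff ℝ ∞ (deriv Real.smoothTransition) :=
  ((Real.smoothTransition.contDiff (n := ⊤)).of_le le_rfl).deriv'

theorem smoothTransition_eventuallyEq_one {t : ℝ} (ht : 1 < t) :
    Real.smoothTransition =ᶠ[𝓝 t] fun _ => 1 := by
  filter_upwards [lt_mem_nhds ht] with s hs using Real.smoothTransition.one_of_one_le hs.le

theorem smoothTransition_sub_eventuallyEq_one {a t : ℝ} (ht : t < a - 1) :
    (fun s => Real.smoothTransition (a - s)) =ᶠ[𝓝 t] fun _ => 1 := by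
  filter_upwards [gt_mem_nhds ht] with s hs
  exact Real.smoothTransition.one_of_one_le (by linarith)

theorem deriv_smoothTransition_eq_zero {t : ℝ} (ht : t ∉ Icc (0 : ℝ) 1) :
    deriv Real.smoothTransition t = 0 := by
  rw [mem_Icc, not_and_or, not_le, not_le] at ht
  rcases ht with ht | ht
  · have h : Real.smoothTransition =ᶠ[𝓝 t] fun _ => 0 := by
      filter_upwards [gt_mem_nhds ht] with s hs using Real.smoothTransition.zero_of_nonpos hs.le
    rw [h.deriv_eq, deriv_const]
  · rw [(smoothTransition_eventuallyEq_one ht).deriv_eq, deriv_const]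

theorem integral_deriv_smoothTransition : ∫ t, deriv Real.smoothTransition t = 1 := by
  have hint : Integrable (deriv Real.smoothTransition) :=
    contDiff_deriv_smoothTransition.continuous.integrable_of_hasCompactSupport
      (HasCompactSupport.intro isCompact_Icc fun _ ht => deriv_smoothTransition_eq_zero ht)
  have h := integral_of_hasDerivAt_of_tendsto (f := Real.smoothTransition) (m := 0) (n := 1)
    (fun t => ((Real.smoothTransition.contDiff (n := 1)).differentiable (by simp) t).hasDerivAt)
    hint
    (tendsto_const_nhds.congr' (by
      filter_upwards [eventually_le_atBot 0] with s hs
      exact (Real.smoothTransition.zero_of_nonpos hs).symm))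
    (tendsto_const_nhds.congr' (by
      filter_upwards [eventually_ge_atTop 1] with s hs
      exact (Real.smoothTransition.one_of_one_le hs).symm))
  rw [h, sub_zero]

end SmoothStep

/-! ### The radial Lagrangian and its variation. -/

section HomotopyFormula

variable {n m k : ℕ} {X : Set (Fin n → ℝ)} {U V : Set (Fin m → ℝ)}
  {A : Fin m → (Fin n → ℝ) × Jet n m k → ℝ} {u₀ : Fin m → ℝ}

/-- The path `u₀ + θ(t) (v - u₀)` of sections from the constant `u₀` to `v`, reparametrized by a
smooth step `θ` so as to be stationary outside `0 ≤ t ≤ 1`. -/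
noncomputable def radialPath (u₀ : Fin m → ℝ) (v : (Fin n → ℝ) → (Fin m → ℝ)) (q : (Fin n → ℝ) × ℝ) :
    Fin m → ℝ :=
  u₀ + Real.smoothTransition q.2 • (v q.1 - u₀)

/-- The value of `u̇^i A_i` at time `s` along the radial path to a section with the jet `q`. -/
noncomputable def homotopyIntegrand (A : Fin m → (Fin n → ℝ) × Jet n m k → ℝ) (u₀ : Fin m → ℝ)
    (q : (Fin n → ℝ) × Jet n m k) (s : ℝ) : ℝ :=
  deriv Real.smoothTransition s * ∑ i, (q.2 i (zeroIndex n k) - u₀ i) *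
    A i (q.1, jet k (fun _ => u₀) 0 + Real.smoothTransition s • (q.2 - jet k (fun _ => u₀) 0))

/-- The Volterra-Vainberg Lagrangian, the integral of `u̇^i A_i` along the radial path. -/
noncomputable def homotopyLagrangian (A : Fin m → (Fin n → ℝ) × Jet n m k → ℝ) (u₀ : Fin m → ℝ)
    (q : (Fin n → ℝ) × Jet n m k) : ℝ :=
  ∫ s : ℝ in univ, homotopyIntegrand A u₀ q s

theorem extendedDensity_eq_zero_of_stationary {u v : (Fin n → ℝ) × ℝ → (Fin m → ℝ)}
    {q : (Fin n → ℝ) × ℝ} (h : u =ᶠ[𝓝 q] v) (hv : ∀ x s t, v (x, s) = v (x, t)) :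
    extendedDensity A u q = 0 := by
  rw [extendedDensity_congr h]
  refine Finset.sum_eq_zero fun i _ => ?_
  have : (fun t => v (q.1, t)) = fun _ => v (q.1, 0) := funext fun t => hv _ _ _
  rw [this, deriv_const, Pi.zero_apply, zero_mul]

theorem contDiffOn_homotopyIntegrand (hV : Convex ℝ V) (hu₀ : u₀ ∈ V)
    (hA : ∀ i, ContDiffOn ℝ ∞ (A i) (jetDomain k X V)) :
    ContDiffOn ℝ ∞ (Function.uncurry (homotopyIntegrand A u₀)) (jetDomain k X V ×ˢ univ) := by
  have hθ : ContDiff ℝ ∞ Real.smoothTransition := Real.smoothTransition.contDiff (n := ⊤)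
  refine (contDiff_deriv_smoothTransition.comp contDiff_snd).contDiffOn.mul
    (ContDiffOn.sum fun i _ => ContDiffOn.mul ?_ ?_)
  · refine ContDiff.contDiffOn ?_
    fun_prop
  · refine (hA i).comp (ContDiff.contDiffOn ?_) ?_
    · exact contDiff_fst.fst.prodMk (contDiff_const.add
        ((hθ.comp contDiff_snd).smul (contDiff_fst.snd.sub contDiff_const)))
    · rintro ⟨q, s⟩ ⟨hq, -⟩
      refine ⟨hq.1, ?_⟩
      have h := hV.add_smul_sub_mem hu₀ hq.2
        ⟨Real.smoothTransition.nonneg s, Real.smoothTransition.le_one s⟩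
      convert! h using 1
      funext i
      simp [jet_zeroIndex]

theorem homotopyIntegrand_eq_zero (q : (Fin n → ℝ) × Jet n m k) {s : ℝ}
    (hs : s ∉ Icc (0 : ℝ) 1) : homotopyIntegrand A u₀ q s = 0 := by
  rw [homotopyIntegrand, deriv_smoothTransition_eq_zero hs, zero_mul]

theorem contDiffOn_homotopyLagrangian (hX : IsOpen X) (hVo : IsOpen V) (hV : Convex ℝ V)
    (hu₀ : u₀ ∈ V) (hA : ∀ i, ContDiffOn ℝ ∞ (A i) (jetDomain k X V)) :
    ContDiffOn ℝ ∞ (homotopyLagrangian A u₀) (jetDomain k X V) :=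
  contDiffOn_setIntegral isOpen_univ isCompact_Icc (subset_univ (Icc (0 : ℝ) 1))
    (isOpen_jetDomain hX hVo) (contDiffOn_homotopyIntegrand hV hu₀ hA)
    fun q _ _ hs => homotopyIntegrand_eq_zero q hs.2

theorem integrable_homotopyIntegrand (hV : Convex ℝ V)
    (hu₀ : u₀ ∈ V) (hA : ∀ i, ContDiffOn ℝ ∞ (A i) (jetDomain k X V))
    {q : (Fin n → ℝ) × Jet n m k} (hq : q ∈ jetDomain k X V) :
    Integrable (homotopyIntegrand A u₀ q) := by
  refine Continuous.integrable_of_hasCompactSupport ?_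
    (HasCompactSupport.intro isCompact_Icc fun s hs => homotopyIntegrand_eq_zero q hs)
  exact (contDiffOn_homotopyIntegrand hV hu₀ hA).continuousOn.comp_continuous
    (Continuous.prodMk_right q) fun s => ⟨hq, mem_univ s⟩

/-- Taking jets is linear, so the density along the radial path depends on `v` only through its
`k`-jet at `x`. This makes the path integral a functional with a local Lagrangian. -/
theorem extendedDensity_radialPath {v : (Fin n → ℝ) → (Fin m → ℝ)} {x : Fin n → ℝ}
    (hv : ContDiffAt ℝ ∞ v x) (t : ℝ) :
    extendedDensity A (radialPath u₀ v) (x, t) = homotopyIntegrand A u₀ (x, jet k v x) t := by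
  have hd : HasDerivAt (fun t => radialPath u₀ v (x, t))
      (deriv Real.smoothTransition t • (v x - u₀)) t := by
    change HasDerivAt (fun t => u₀ + Real.smoothTransition t • (v x - u₀)) _ t
    exact (((Real.smoothTransition.contDiffAt (n := 1)).differentiableAt
      (by simp)).hasDerivAt.smul_const _).const_add _
  have hj : jet k (fun x => radialPath u₀ v (x, t)) x = jet k (fun _ => u₀) 0 +
      Real.smoothTransition t • (jet k v x - jet k (fun _ => u₀) 0) := by
    have h1 : (fun x => radialPath u₀ v (x, t)) =
        (fun _ => u₀) + Real.smoothTransition t • (v + (-1 : ℝ) • fun _ => u₀) := by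
      funext y
      simp [radialPath, sub_eq_add_neg]
    have h2 : ContDiffAt ℝ ∞ ((-1 : ℝ) • fun _ : Fin n → ℝ => u₀) x := contDiffAt_const
    have h3 : ContDiffAt ℝ ∞ (v + (-1 : ℝ) • fun _ : Fin n → ℝ => u₀) x := hv.add h2
    rw [h1, jet_add_smul contDiffAt_const h3, jet_add_smul hv contDiffAt_const,
      jet_const u₀ x 0, neg_one_smul, ← sub_eq_add_neg]
  simp only [extendedDensity, hd.deriv, hj, homotopyIntegrand, Finset.mul_sum, jet_zeroIndex]
  refine Finset.sum_congr rfl fun i _ => ?_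
  simp [mul_assoc]

theorem radialPath_mem (hV : Convex ℝ V) (hu₀ : u₀ ∈ V) {v : (Fin n → ℝ) → (Fin m → ℝ)}
    {q : (Fin n → ℝ) × ℝ} (hv : v q.1 ∈ V) : radialPath u₀ v q ∈ V :=
  hV.add_smul_sub_mem hu₀ hv ⟨Real.smoothTransition.nonneg _, Real.smoothTransition.le_one _⟩

theorem contDiffOn_radialPath {v : (Fin n → ℝ) → (Fin m → ℝ)} (hv : ContDiffOn ℝ ∞ v X) :
    ContDiffOn ℝ ∞ (radialPath u₀ v) (X ×ˢ univ) := by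
  have hθ : ContDiff ℝ ∞ Real.smoothTransition := Real.smoothTransition.contDiff (n := ⊤)
  have hv' : ContDiffOn ℝ ∞ (fun q : (Fin n → ℝ) × ℝ => v q.1) (X ×ˢ univ) :=
    hv.comp contDiff_fst.contDiffOn fun z hz => hz.1
  exact contDiffOn_const.add ((hθ.comp contDiff_snd).contDiffOn.smul (hv'.sub contDiffOn_const))

/-- The radial path has the Volterra-Vainberg functional of its end point as its action. -/
theorem setIntegral_extendedDensity_radialPath_sub (hX : IsOpen X) (hV : Convex ℝ V)
    (hu₀ : u₀ ∈ V) (hA : ∀ i, ContDiffOn ℝ ∞ (A i) (jetDomain k X V))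
    {u v : (Fin n → ℝ) → (Fin m → ℝ)} (hu : IsSection X V u) (hv : IsSection X V v)
    {K : Set (Fin n → ℝ)} (hK : IsCompact K) (hKX : K ⊆ X) (huv : ∀ x ∉ K, v =ᶠ[𝓝 x] u) :
    IntegrableOn (fun q => extendedDensity A (radialPath u₀ v) q -
      extendedDensity A (radialPath u₀ u) q) (X ×ˢ univ) ∧
    ∫ q in X ×ˢ univ, (extendedDensity A (radialPath u₀ v) q -
      extendedDensity A (radialPath u₀ u) q) =
    ∫ x in X, (lagrangianDensity (homotopyLagrangian A u₀) v x -
      lagrangianDensity (homotopyLagrangian A u₀) u x) := by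
  have hΩ : IsOpen (X ×ˢ (univ : Set ℝ)) := hX.prod isOpen_univ
  have hc : ∀ {v : (Fin n → ℝ) → (Fin m → ℝ)}, IsSection X V v →
      ContinuousOn (extendedDensity A (radialPath u₀ v)) (X ×ˢ univ) := by
    intro v hv
    have hsec : IsSection (X ×ˢ univ) V (radialPath u₀ v) :=
      ⟨contDiffOn_radialPath hv.smooth, fun q hq => radialPath_mem hV hu₀ (hv.mapsTo hq.1)⟩
    exact hsec.continuousOn_extendedDensity hX hA
  have hint : IntegrableOn (fun q => extendedDensity A (radialPath u₀ v) q -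
      extendedDensity A (radialPath u₀ u) q) (X ×ˢ univ) := by
    refine integrableOn_of_eq_zero_off_compact hΩ (hK.prod (isCompact_Icc (a := (0 : ℝ)) (b := 1)))
      (prod_mono hKX (subset_univ _)) ((hc hv).sub (hc hu)) ?_
    rintro ⟨x, t⟩ ⟨⟨hx, -⟩, hxt⟩
    rw [extendedDensity_radialPath (hv.smooth.contDiffAt (hX.mem_nhds hx)),
      extendedDensity_radialPath (hu.smooth.contDiffAt (hX.mem_nhds hx))]
    by_cases hxK : x ∈ K
    · have ht : t ∉ Icc (0 : ℝ) 1 := fun ht => hxt ⟨hxK, ht⟩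
      rw [homotopyIntegrand_eq_zero _ ht, homotopyIntegrand_eq_zero _ ht, sub_self]
    · rw [jet_congr (huv x hxK), sub_self]
  refine ⟨hint, ?_⟩
  rw [IntegrableOn, volume_restrict_prod_univ] at hint
  -- Fubini, with `t` integrated first. Only the difference of the two densities is known to be
  -- integrable over `X × ℝ`; for fixed `x` each one is integrable in `t`.
  rw [volume_restrict_prod_univ, integral_prod _ hint]
  refine setIntegral_congr_fun hX.measurableSet fun x hx => ?_
  simp only [extendedDensity_radialPath (hv.smooth.contDiffAt (hX.mem_nhds hx)),
      extendedDensity_radialPath (hu.smooth.contDiffAt (hX.mem_nhds hx)), lagrangianDensity,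
      homotopyLagrangian, Measure.restrict_univ]
  exact integral_sub
    (integrable_homotopyIntegrand hV hu₀ hA (mem_jetDomain.2 ⟨hx, hv.mapsTo hx⟩))
    (integrable_homotopyIntegrand hV hu₀ hA (mem_jetDomain.2 ⟨hx, hu.mapsTo hx⟩))

/-- The action of the path along which `u + ε η` returns to `u` during `2 ≤ t ≤ 3`. -/
theorem hasDerivAt_setIntegral_returnPath (hX : IsOpen X)
    (hVo : IsOpen V) (hA : ∀ i, ContDiffOn ℝ ∞ (A i) (jetDomain k X V))
    {u η : (Fin n → ℝ) → (Fin m → ℝ)} (hu : IsSection X V u) (hη : IsTestVariation X η)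
    {s : Set ℝ} (hs : IsOpen s) (hs0 : (0 : ℝ) ∈ s)
    (hsV : ∀ ε ∈ s, ∀ t : ℝ, ∀ x ∈ X, u x + (ε * Real.smoothTransition (3 - t)) • η x ∈ V) :
    (∀ ε ∈ s, IntegrableOn (extendedDensity A fun q : (Fin n → ℝ) × ℝ =>
        u q.1 + (ε * Real.smoothTransition (3 - q.2)) • η q.1) (X ×ˢ univ)) ∧
    HasDerivAt (fun ε : ℝ => ∫ q in X ×ˢ univ,
        extendedDensity A (fun q => u q.1 + (ε * Real.smoothTransition (3 - q.2)) • η q.1) q)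
      (-∫ x in X, ∑ i, η x i * A i (x, jet k u x)) 0 := by
  have hΩ : IsOpen (X ×ˢ (univ : Set ℝ)) := hX.prod isOpen_univ
  set W : ℝ → (Fin n → ℝ) × ℝ → (Fin m → ℝ) := fun ε q =>
    u q.1 + (ε * Real.smoothTransition (3 - q.2)) • η q.1 with hW
  have hθ : ContDiff ℝ ∞ Real.smoothTransition := Real.smoothTransition.contDiff (n := ⊤)
  have hWs : ContDiffOn ℝ ∞ (Function.uncurry W) (s ×ˢ (X ×ˢ univ)) := by
    refine (hu.smooth.comp contDiff_snd.fst.contDiffOn fun z hz => hz.2.1).add ?_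
    exact ((contDiff_fst.mul (hθ.comp (contDiff_const.sub contDiff_snd.snd))).smul
      (hη.smooth.comp contDiff_snd.fst)).contDiffOn
  have hd : ContDiffOn ℝ ∞ (Function.uncurry fun ε => extendedDensity A (W ε))
      (s ×ˢ (X ×ˢ univ)) :=
    contDiffOn_extendedDensity hA (hs.prod hΩ) hWs fun z hz =>
      ⟨hz.2.1, hsV _ hz.1 _ _ hz.2.1⟩
  -- The velocity carries a factor `ε`. The derivative at `ε = 0` is therefore the other factor at
  -- `ε = 0`, and no derivative of `A` enters.
  have hformula : ∀ ε x t, extendedDensity A (W ε) (x, t) =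
      ε * (-deriv Real.smoothTransition (3 - t) * ∑ i, η x i * lagrangianDensity (A i)
        (fun x => W ε (x, t)) x) := by
    intro ε x t
    have h1 : HasDerivAt (fun t => W ε (x, t))
        ((ε * -deriv Real.smoothTransition (3 - t)) • η x) t := by
      have h := (hθ.differentiable (by simp) (3 - t)).hasDerivAt.comp_const_sub 3 t
      exact ((h.const_mul ε).smul_const (η x)).const_add (u x)
    simp only [extendedDensity, h1.deriv, lagrangianDensity, Finset.mul_sum]
    refine Finset.sum_congr rfl fun i _ => ?_
    simp only [Pi.smul_apply, smul_eq_mul]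
    ring
  have hKc : IsCompact (tsupport η ×ˢ Icc (2 : ℝ) 3) := hη.compact.isCompact.prod isCompact_Icc
  have hKΩ : tsupport η ×ˢ Icc (2 : ℝ) 3 ⊆ X ×ˢ univ :=
    prod_mono hη.support_subset (subset_univ _)
  have hzero : ∀ ε ∈ s, ∀ q ∈ (X ×ˢ univ) \ (tsupport η ×ˢ Icc (2 : ℝ) 3),
      extendedDensity A (W ε) q = 0 := by
    rintro ε - ⟨x, t⟩ ⟨-, hq⟩
    rw [hformula]
    by_cases hx : x ∈ tsupport η
    · rw [deriv_smoothTransition_eq_zero fun ht => hq ⟨hx, by linarith [ht.2], by linarith [ht.1]⟩]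
      simp
    · simp [image_eq_zero_of_notMem_tsupport hx]
  refine ⟨fun ε hε => integrableOn_of_eq_zero_off_compact hΩ hKc hKΩ
    (hd.continuousOn.comp (Continuous.prodMk_right ε).continuousOn fun q hq => ⟨hε, hq⟩)
    (hzero ε hε), ?_⟩
  have h := hasDerivAt_setIntegral (μ := volume) hΩ hKc hKΩ hs hs0 hd hzero
  convert! h using 1
  have hpt : ∀ q ∈ X ×ˢ (univ : Set ℝ), deriv (fun ε => extendedDensity A (W ε) q) 0 =
      (∑ i, η q.1 i * A i (q.1, jet k u q.1)) * -deriv Real.smoothTransition (3 - q.2) := by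
    rintro ⟨x, t⟩ ⟨hx, -⟩
    simp only [hformula]
    have hL : ∀ i, DifferentiableAt ℝ
        (fun ε => lagrangianDensity (A i) (fun x => W ε (x, t)) x) 0 := fun i =>
      (hasDerivAt_lagrangianDensity hX hVo (hA i) (W := fun ε x => W ε (x, t)) (hs.prod hX)
        (hWs.comp (contDiff_fst.prodMk (contDiff_snd.prodMk contDiff_const)).contDiffOn
          fun z hz => ⟨hz.1, hz.2, mem_univ _⟩) ⟨hs0, hx⟩ hx (hsV 0 hs0 t x hx)).differentiableAt
    have hh : DifferentiableAt ℝ (fun ε => -deriv Real.smoothTransition (3 - t) *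
        ∑ i, η x i * lagrangianDensity (A i) (fun x => W ε (x, t)) x) 0 :=
      (DifferentiableAt.fun_sum fun i _ => (hL i).const_mul _).const_mul _
    have h1 := (hasDerivAt_id (0 : ℝ)).mul hh.hasDerivAt
    refine h1.deriv.trans ?_
    have hW0 : (fun x => W 0 (x, t)) = u := by simp [hW]
    simp only [id, one_mul, zero_mul, add_zero, hW0, lagrangianDensity]
    ring
  rw [setIntegral_congr_fun hΩ.measurableSet hpt, volume_restrict_prod_univ,
    integral_prod_mul (fun x => ∑ i, η x i * A i (x, jet k u x))
      (fun t => -deriv Real.smoothTransition (3 - t)), integral_neg,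
    integral_sub_left_eq_self (deriv Real.smoothTransition) volume 3,
    integral_deriv_smoothTransition, mul_neg_one]

/-- The path `u₀ → u + εη → u` is a compactly supported deformation of the radial path to `u`.
Stationarity of the functional there trades the derivative of the radial part for minus that of the
return leg. -/
theorem isVariationalDerivative_homotopyLagrangian (hX : IsOpen X)
    (hVo : IsOpen V) (hV : Convex ℝ V) (hu₀ : u₀ ∈ V) (hVU : V ⊆ U)
    (hA : ∀ i, ContDiffOn ℝ ∞ (A i) (jetDomain k X V))
    (h : ∀ u η : (Fin n → ℝ) × ℝ → (Fin m → ℝ), IsSection (X ×ˢ univ) U u →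
      IsTestVariation (X ×ˢ univ) η → HasVariation (X ×ˢ univ) (extendedDensity A) u η 0) :
    IsVariationalDerivative X V (homotopyLagrangian A u₀) A := by
  intro u η hu hη
  have hθ : ContDiff ℝ ∞ Real.smoothTransition := Real.smoothTransition.contDiff (n := ⊤)
  have hΩ : IsOpen (X ×ˢ (univ : Set ℝ)) := hX.prod isOpen_univ
  obtain ⟨s', hs', hs0', hsV'⟩ := exists_isOpen_forall_mem hX hη.compact.isCompact
    hη.support_subset hVo (W := fun ε : ℝ => u + ε • η) (p₀ := 0)
    ((hu.smooth.continuousOn.comp continuousOn_snd fun z hz => hz.2).add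
      (continuous_fst.smul (hη.smooth.continuous.comp continuous_snd)).continuousOn)
    (by simpa using hu.mapsTo)
    (fun p q hq => by simp [image_eq_zero_of_notMem_tsupport hq.2])
  obtain ⟨r, hr, hrs⟩ := Metric.isOpen_iff.1 hs' 0 hs0'
  -- The step function takes values in `[0, 1]`, so the effective parameter stays in the ball of
  -- radius `r`.
  have hsV : ∀ ε ∈ Metric.ball (0 : ℝ) r, ∀ t : ℝ, ∀ x ∈ X,
      u x + (ε * Real.smoothTransition (3 - t)) • η x ∈ V := by
    intro ε hε t x hx
    refine hsV' _ (hrs ?_) x hx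
    rw [mem_ball_zero_iff, norm_mul, Real.norm_of_nonneg (Real.smoothTransition.nonneg _)]
    rw [mem_ball_zero_iff] at hε
    exact (mul_le_of_le_one_right (norm_nonneg _) (Real.smoothTransition.le_one _)).trans_lt hε
  -- It rises with the radial path on `[0, 1]`, equals `1` on `[1, 2]` and falls on `[2, 3]`. The
  -- plateau separates the outward leg from the return leg.
  set ζ : ℝ → ℝ := fun t => Real.smoothTransition t * Real.smoothTransition (3 - t) with hζ
  have hζs : ContDiff ℝ ∞ ζ := hθ.mul (hθ.comp (contDiff_const.sub contDiff_id))
  set σ : (Fin n → ℝ) × ℝ → (Fin m → ℝ) := fun q => ζ q.2 • η q.1 with hσ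
  have hσsupp : Function.support σ ⊆ tsupport η ×ˢ Icc (0 : ℝ) 3 := by
    rintro ⟨x, t⟩ hq
    refine ⟨by_contra fun hx => hq ?_, by_contra fun ht => hq ?_⟩
    · simp [hσ, image_eq_zero_of_notMem_tsupport hx]
    · rw [mem_Icc, not_and_or, not_le, not_le] at ht
      rcases ht with ht | ht
      · simp [hσ, hζ, Real.smoothTransition.zero_of_nonpos ht.le]
      · simp [hσ, hζ, Real.smoothTransition.zero_of_nonpos (sub_nonpos.2 ht.le)]
  have hKc : IsCompact (tsupport η ×ˢ Icc (0 : ℝ) 3) := hη.compact.isCompact.prod isCompact_Icc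
  have hσtest : IsTestVariation (X ×ˢ univ) σ :=
    ⟨(hζs.comp contDiff_snd).smul (hη.smooth.comp contDiff_fst),
      HasCompactSupport.of_support_subset_isCompact hKc hσsupp,
      (closure_minimal hσsupp hKc.isClosed).trans
        (prod_mono hη.support_subset (subset_univ _))⟩
  have hpath : IsSection (X ×ˢ univ) U (radialPath u₀ u) :=
    ⟨contDiffOn_radialPath hu.smooth, fun q hq => hVU (radialPath_mem hV hu₀ (hu.mapsTo hq.1))⟩
  have hvar := h _ _ hpath hσtest
  have hret := hasDerivAt_setIntegral_returnPath hX hVo hA hu hη Metric.isOpen_ball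
    (Metric.mem_ball_self hr) hsV
  have hfinal := HasDerivAt.sub hvar hret.2
  rw [zero_sub, neg_neg] at hfinal
  refine hfinal.congr_of_eventuallyEq ?_
  filter_upwards [Metric.ball_mem_nhds (0 : ℝ) hr] with ε hε
  have hv : IsSection X V (u + ε • η) :=
    ⟨hu.smooth.add (contDiff_const.smul hη.smooth).contDiffOn, fun x hx => hsV' ε (hrs hε) x hx⟩
  have hrad := setIntegral_extendedDensity_radialPath_sub hX hV hu₀ hA hu hv hη.compact.isCompact
    hη.support_subset fun x hx => by
      filter_upwards [eventuallyEq_zero_of_notMem_tsupport hx] with y hy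
      simp [hy]
  rw [Pi.sub_apply, eq_sub_iff_add_eq, ← hrad.2, ← integral_add hrad.1 (hret.1 ε hε)]
  refine setIntegral_congr_fun hΩ.measurableSet ?_
  rintro ⟨x, t⟩ -
  -- Before `t = 2` the deformed path is the radial path to `u + εη` and the return path is at rest.
  -- From `t = 2` on, the radial paths are at rest and the deformed path is the return path.
  by_cases ht : t < 2
  · have hone : ∀ᶠ q : (Fin n → ℝ) × ℝ in 𝓝 (x, t), Real.smoothTransition (3 - q.2) = 1 :=
      (continuous_snd.tendsto (x, t)).eventually
        (smoothTransition_sub_eventuallyEq_one (a := 3) (show t < 3 - 1 by linarith))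
    have e1 : radialPath u₀ u + ε • σ =ᶠ[𝓝 (x, t)] radialPath u₀ (u + ε • η) := by
      filter_upwards [hone] with q hq
      funext i
      simp only [radialPath, hσ, hζ, hq, Pi.add_apply, Pi.smul_apply, Pi.sub_apply, smul_eq_mul]
      ring
    have e2 : extendedDensity A (fun q : (Fin n → ℝ) × ℝ =>
        u q.1 + (ε * Real.smoothTransition (3 - q.2)) • η q.1) (x, t) = 0 := by
      refine extendedDensity_eq_zero_of_stationary (v := fun q => u q.1 + ε • η q.1) ?_
        fun _ _ _ => rfl
      filter_upwards [hone] with q hq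
      rw [hq, mul_one]
    simp only [extendedDensity_congr e1, e2, add_zero]
  · have hone : ∀ᶠ q : (Fin n → ℝ) × ℝ in 𝓝 (x, t), Real.smoothTransition q.2 = 1 :=
      (continuous_snd.tendsto (x, t)).eventually
        (smoothTransition_eventuallyEq_one (show 1 < t by linarith))
    have e1 : radialPath u₀ u + ε • σ =ᶠ[𝓝 (x, t)] fun q : (Fin n → ℝ) × ℝ =>
        u q.1 + (ε * Real.smoothTransition (3 - q.2)) • η q.1 := by
      filter_upwards [hone] with q hq
      funext i
      simp only [radialPath, hσ, hζ, hq, Pi.add_apply, Pi.smul_apply, Pi.sub_apply, smul_eq_mul]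
      ring
    have e2 : ∀ v : (Fin n → ℝ) → (Fin m → ℝ),
        extendedDensity A (radialPath u₀ v) (x, t) = 0 := fun v => by
      refine extendedDensity_eq_zero_of_stationary (v := fun q => v q.1) ?_ fun _ _ _ => rfl
      filter_upwards [hone] with q hq
      simp [radialPath, hq]
    simp only [extendedDensity_congr e1, e2, sub_zero, zero_add]

end HomotopyFormula

end InverseProblem

/-! ### The equivalence. -/

open InverseProblem
theorem theorem1 (n m k : ℕ) (X : Set (Fin n → ℝ)) (hX : IsOpen X)
    (U : Set (Fin m → ℝ)) (hU : IsOpen U)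
    (A : Fin m → (Fin n → ℝ) × Jet n m k → ℝ)
    (hA : ∀ i, ContDiffOn ℝ ∞ (A i) (jetDomain k X U)) :
    IsLocallyVariational X U A ↔
      ∀ u η : (Fin n → ℝ) × ℝ → (Fin m → ℝ),
        IsSection (X ×ˢ Set.univ) U u → IsTestVariation (X ×ˢ Set.univ) η →
          HasVariation (X ×ˢ Set.univ) (extendedDensity A) u η 0 := by
  refine ⟨fun h u η hu hη => h.hasVariation_extendedDensity hX hU hA hu hη, fun h u₀ hu₀ => ?_⟩
  obtain ⟨r, hr, hrU⟩ := Metric.isOpen_iff.1 hU u₀ hu₀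
  have hAV := fun i => (hA i).mono (jetDomain_mono hrU)
  have hmem := Metric.mem_ball_self (x := u₀) hr
  -- A ball is convex, so radial paths from `u₀` stay inside it. The Lagrangian has the same order
  -- `k` as the `A_i`.
  exact ⟨Metric.ball u₀ r, Metric.isOpen_ball, hmem, hrU, k, homotopyLagrangian A u₀,
    contDiffOn_homotopyLagrangian hX Metric.isOpen_ball (convex_ball u₀ r) hmem hAV,
    isVariationalDerivative_homotopyLagrangian hX Metric.isOpen_ball (convex_ball u₀ r) hmem hrU
      hAV h⟩
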